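/- **Setting.** Let $U=\{z\in\mathbb{Z}^d:|z_1|+\dots+|z_d|=1\}$. A space-time environment is a family $\omega=(\omega_{n,x})_{n\in\mathbb{Z},x\in\mathbb{Z}^d}$ of probability vectors $\omega_{n,x}=(\pi_{n,n+1}(x,x+z))_{z\in U}$. Let $\Omega$ be the space of environments with its product Borel $\sigma$-algebra and let $\mathbb{P}$ be a probability measure on $\Omega$ under which the $\omega_{n,x}$ are i.i.d. Assume uniform ellipticity: there is $c_1>0$ with $\mathbb{P}(\pi_{0,1}(0,z)\ge c_1)=1$ for every $z\in U$. Given $\omega$, let $P^\omega_{o,o}$ be the law of the walk $(X_n)_{n\ge0}$ with $X_0=0$ that jumps from $x$ at time $n$ to $x+z$ at time $n+1$ with probability $\pi_{n,n+1}(x,x+z)$. Let $P_{o,o}=\mathbb{P}\times P^\omega_{o,o}$ be the semi-direct product (the averaged measure), with expectation $E_{o,o}$, and let $Z_i=X_i-X_{i-1}$. Put $(T_{m,y}\omega)_{n,x}=\omega_{n+m,x+y}$, let $\mathcal{B}_n^-$ and $\mathcal{B}_n^+$ be the $\sigma$-algebras on $\Omega$ generated by $(\omega_{m,x})_{m\le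 n,\,x\in\mathbb{Z}^d}$ and $(\omega_{m,x})_{m\ge n,\,x\in\mathbb{Z}^d}$ respectively, and set $$q(z)=\mathbb{E}[\pi_{0,1}(0,z)],\qquad \Lambda_c(\theta)=\log\sum_{z\in U}q(z)e^{\langle\theta,z\rangle},\qquad \mathcal{D}=\{\xi\in\mathbb{R}^d:|\xi_1|+\dots+|\xi_d|\le1\}.$$ For $N,M,K\in\mathbb{N}=\{0,1,2,\dots\}$ call $f:\Omega\times U^{\{1,2,\dots\}}\to\mathbb{R}$ *$(N,M,K)$-local* if $f$ is bounded, $f(\omega,(z_i)_{i\ge1})$ does not depend on $(z_i)_{i>K}$, and $f(\cdot,(z_i)_{i\ge1})$ is $\mathcal{B}_{-N}^+\cap\mathcal{B}_M^-$-measurable for each $(z_i)_{i\ge1}$. The empirical process of the environment Markov chain is the random measure $$\bar\nu_{n,X}^\infty=\frac1n\sum_{j=0}^{n-1}\mathbf{1}_{T_{j,X_j}\omega,\,(Z_{j+i})_{i\ge1}}$$ on $\Omega\times U^{\{1,2,\dots\}}$, where $\mathbf{1}_p$ is the unit point mass at $p$. **Theorem.** Let $\xi$ be in the interior of $\mathcal{D}$.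 Then there is a unique $\theta\in\mathbb{R}^d$ with $\nabla\Lambda_c(\theta)=\xi$, and there is a unique probability measure $\bar\mu_\xi^\infty$ on $\Omega\times U^{\{1,2,\dots\}}$ such that, for all $N,M,K\in\mathbb{N}$ and all $(N,M,K)$-local $f$, $$\int f\,d\bar\mu_\xi^\infty=E_{o,o}\Big[e^{\langle\theta,X_{N+M+K+1}\rangle-(N+M+K+1)\Lambda_c(\theta)}\,f\big(T_{N,X_N}\omega,(Z_{N+i})_{i\ge1}\big)\Big].$$ Moreover, for every $\delta>0$ one has $P_{o,o}(|X_n/n-\xi|\le\delta)>0$ for all large $n$, and for all $N,M,K\in\mathbb{N}$, all $(N,M,K)$-local $f$ and all $\epsilon>0$, $$\limsup_{\delta\to0}\ \limsup_{n\to\infty}\ \frac1n\log P_{o,o}\Big(\Big|\int f\,d\bar\nu_{n,X}^\infty-\int f\,d\bar\mu_\xi^\infty\Big|>\epsilon\ \Big|\ \Big|\frac{X_n}n-\xi\Big|\le\delta\Big)<0,$$ where $|\cdot|$ is the Euclidean norm on $\mathbb{R}^d$, $\delta\to 0$ through positive values, and $\log 0=-\infty$. -/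

import Mathlib

open MeasureTheory ProbabilityTheory Filter Topology
open scoped ENNReal

namespace SpaceTimeRWRE

/-- The nearest-neighbour steps `U = {z ∈ ℤ^d : |z_1| + ⋯ + |z_d| = 1}` (see `mem_stepSet`). -/
noncomputable def stepSet (d : ℕ) : Finset (Fin d → ℤ) :=
  (Fintype.piFinset fun _ => Finset.Icc (-1) 1).filter fun z => ∑ i, |z i| = 1

theorem mem_stepSet {d : ℕ} (z : Fin d → ℤ) : z ∈ stepSet d ↔ ∑ i, |z i| = 1 := by
  simp only [stepSet, Finset.mem_filter, Fintype.mem_piFinset, Finset.mem_Icc,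
    and_iff_right_iff_imp]
  intro h i
  have h1 : |z i| ≤ ∑ j, |z j| :=
    Finset.single_le_sum (f := fun j => |z j|) (fun j _ => abs_nonneg _) (Finset.mem_univ i)
  exact abs_le.1 (h1.trans h.le)

/-- The type of nearest-neighbour steps. -/
abbrev Step (d : ℕ) : Type := {z : Fin d → ℤ // z ∈ stepSet d}

/-- The environment at one space-time point: a probability vector `(π(z))_{z ∈ U}`. -/
abbrev LocalEnv (d : ℕ) : Type := stdSimplex ℝ (Step d)

/-- The space `Ω` of space-time environments; `(ω (n, x)).1 z` is `π_{n,n+1}(x, x + z)`. -/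
abbrev Env (d : ℕ) : Type := ℤ × (Fin d → ℤ) → LocalEnv d

/-- The space `Ω × U^ℕ`. In `(ω, z)`, the entry `z i` is the `(i+1)`-st step `Z_{i+1}`. -/
abbrev EnvSteps (d : ℕ) : Type := Env d × (ℕ → Step d)

/-- The position `X_n = Z_1 + ⋯ + Z_n` of the walk that starts at the origin. -/
def pos {d : ℕ} (z : ℕ → Step d) (n : ℕ) : Fin d → ℤ := ∑ i ∈ Finset.range n, (z i).1

/-- A lattice point as a vector of Euclidean space. -/
noncomputable def toEuclid {d : ℕ} (x : Fin d → ℤ) : EuclideanSpace ℝ (Fin d) :=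
  WithLp.toLp 2 fun i => (x i : ℝ)

/-- The space-time shift `(T_{m,y} ω)_{n,x} = ω_{n+m,x+y}`. -/
def shift {d : ℕ} (m : ℤ) (y : Fin d → ℤ) (ω : Env d) : Env d := fun p => ω (p.1 + m, p.2 + y)

/-- The σ-algebra `𝓑_n^-` generated by `ω_{m,x}`, `m ≤ n`. -/
@[reducible] def past (d : ℕ) (n : ℤ) : MeasurableSpace (Env d) :=
  ⨆ p : {p : ℤ × (Fin d → ℤ) // p.1 ≤ n}, MeasurableSpace.comap (fun ω => ω p.1) inferInstance

/-- The σ-algebra `𝓑_n^+` generated by `ω_{m,x}`, `m ≥ n`. -/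
@[reducible] def future (d : ℕ) (n : ℤ) : MeasurableSpace (Env d) :=
  ⨆ p : {p : ℤ × (Fin d → ℤ) // n ≤ p.1}, MeasurableSpace.comap (fun ω => ω p.1) inferInstance

/-- The law `ℙ` of the environment: the `ω_{n,x}` are i.i.d. with law `ρ`. -/
noncomputable def envMeasure {d : ℕ} (ρ : Measure (LocalEnv d)) : Measure (Env d) :=
  Measure.infinitePi fun _ => ρ

instance {d : ℕ} (ρ : Measure (LocalEnv d)) [IsProbabilityMeasure ρ] :
    IsProbabilityMeasure (envMeasure ρ) := by
  unfold envMeasure; infer_instance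

/-- The law on `U` of one step taken with the probability vector `s`. -/
noncomputable def stepLaw {d : ℕ} (s : LocalEnv d) : Measure (Step d) :=
  ∑ z, ENNReal.ofReal (s.1 z) • Measure.dirac z

theorem stepLaw_singleton {d : ℕ} (s : LocalEnv d) (z : Step d) :
    stepLaw s {z} = ENNReal.ofReal (s.1 z) := by
  simp [stepLaw, Set.indicator_apply]

instance {d : ℕ} (s : LocalEnv d) : IsProbabilityMeasure (stepLaw s) := by
  constructor
  have h : ∑ z, ENNReal.ofReal (s.1 z) = 1 := by
    rw [← ENNReal.ofReal_sum_of_nonneg fun z _ => s.2.1 z, s.2.2, ENNReal.ofReal_one]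
  simpa [stepLaw] using h

/-- Transition mechanism in the environment `ω`: if the first `n + 1` steps are `h`, the walk is at
`x = ∑ h` at time `n + 1`, and its next step has the law given by `ω_{n+1,x}`. -/
noncomputable def stepKernel {d : ℕ} (ω : Env d) (n : ℕ) :
    Kernel (Π _ : Finset.Iic n, Step d) (Step d) :=
  Kernel.ofFunOfCountable fun h => stepLaw (ω (((n + 1 : ℕ) : ℤ), ∑ i, (h i).1))

instance {d : ℕ} (ω : Env d) (n : ℕ) : IsMarkovKernel (stepKernel ω n) :=
  ⟨fun _ => inferInstanceAs (IsProbabilityMeasure (stepLaw _))⟩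

/-- The quenched measure `P_{o,o}^ω`, as a law of the step sequence `(Z_i)_{i ≥ 1}` of the walk that
starts at the origin at time `0`. -/
noncomputable def quenchedMeasure {d : ℕ} (ω : Env d) : Measure (ℕ → Step d) :=
  Kernel.trajMeasure (X := fun _ => Step d) (stepLaw (ω (0, 0))) (stepKernel ω)

instance {d : ℕ} (ω : Env d) : IsProbabilityMeasure (quenchedMeasure ω) := by
  unfold quenchedMeasure; infer_instance

/-- `P_{o,o}^ω(Z_1 = a_1, …, Z_{n+1} = a_{n+1}) = ∏_{i ≤ n} π_{i,i+1}(x_i, x_{i+1})` along the path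
`x` with steps `a`. -/
theorem quenchedMeasure_cylinder {d : ℕ} (ω : Env d) (a : ℕ → Step d) (n : ℕ) :
    quenchedMeasure ω {z | ∀ i ≤ n, z i = a i} =
      ∏ i ∈ Finset.range (n + 1), ENNReal.ofReal ((ω ((i : ℤ), pos a i)).1 (a i)) := by
  have hset : ∀ m : ℕ, {z : ℕ → Step d | ∀ i ≤ m, z i = a i} =
      Preorder.frestrictLe (π := fun _ => Step d) m ⁻¹'
        {Preorder.frestrictLe (π := fun _ => Step d) m a} := by
    intro m
    ext z
    simp [funext_iff, Preorder.frestrictLe]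
  induction n with
  | zero =>
    have h0 : (quenchedMeasure ω).map (Preorder.frestrictLe (π := fun _ => Step d) 0) =
        (stepLaw (ω (0, 0))).map
          (MeasurableEquiv.piUnique (fun _ : Finset.Iic 0 => Step d)).symm := by
      unfold quenchedMeasure Kernel.trajMeasure
      rw [Measure.map_comp _ _ (by fun_prop), Kernel.traj_map_frestrictLe]
      simp
    rw [hset, ← Measure.map_apply (by fun_prop) (measurableSet_singleton _), h0,
      Measure.map_apply (MeasurableEquiv.measurable _) (measurableSet_singleton _)]
    have h1 : (MeasurableEquiv.piUnique (fun _ : Finset.Iic 0 => Step d)).symm ⁻¹'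
        {Preorder.frestrictLe (π := fun _ => Step d) 0 a} = {a 0} := by
      ext z
      rw [Set.mem_preimage, Set.mem_singleton_iff, Set.mem_singleton_iff,
        MeasurableEquiv.symm_apply_eq]
      rfl
    rw [h1, stepLaw_singleton]
    simp [pos]
  | succ n ih =>
    have h2 : {z : ℕ → Step d | ∀ i ≤ n + 1, z i = a i} =
        (fun z : ℕ → Step d => (Preorder.frestrictLe (π := fun _ => Step d) n z, z (n + 1))) ⁻¹'
          ({Preorder.frestrictLe (π := fun _ => Step d) n a} ×ˢ {a (n + 1)}) := by
      ext z
      simp only [Nat.le_add_one_iff, Set.mem_ofPred_eq, Set.mem_preimage, Set.mem_prod,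
        Set.mem_singleton_iff, funext_iff, Preorder.frestrictLe, Finset.restrict_def,
        Subtype.forall, Finset.mem_Iic]
      constructor
      · exact fun h => ⟨fun i hi => h i (Or.inl hi), h _ (Or.inr rfl)⟩
      · rintro ⟨h, h'⟩ i (hi | rfl)
        · exact h i hi
        · exact h'
    have h3 := Kernel.map_frestrictLe_trajMeasure_compProd_eq_map_trajMeasure
      (X := fun _ => Step d) (μ₀ := stepLaw (ω (0, 0))) (κ := stepKernel ω) (a := n)
    have hm : Measurable (fun z : ℕ → Step d =>
        (Preorder.frestrictLe (π := fun _ => Step d) n z, z (n + 1))) := by fun_prop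
    rw [h2, ← Measure.map_apply hm
      ((measurableSet_singleton _).prod (measurableSet_singleton _))]
    unfold quenchedMeasure at ih ⊢
    rw [← h3, Measure.compProd_apply_prod (measurableSet_singleton _) (measurableSet_singleton _),
      Measure.restrict_singleton, lintegral_smul_measure, lintegral_dirac,
      Measure.map_apply (by fun_prop) (measurableSet_singleton _), ← hset, ih,
      Finset.prod_range_succ _ (n + 1), smul_eq_mul]
    congr 1
    change stepLaw _ {a (n + 1)} = _
    rw [stepLaw_singleton]
    have h4 : ∑ i : Finset.Iic n, (Preorder.frestrictLe (π := fun _ => Step d) n a i).1 =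
        pos a (n + 1) := by
      have h5 : Finset.range (n + 1) = Finset.Iic n := by ext; simp
      rw [pos, h5]
      exact Finset.sum_coe_sort (Finset.Iic n) fun i => (a i).1
    rw [h4]

theorem measurable_quenchedMeasure (d : ℕ) :
    Measurable (quenchedMeasure : Env d → Measure (ℕ → Step d)) := by
  let S : Set (Set (ℕ → Step d)) :=
    {s | ∃ (n : ℕ) (a : ℕ → Step d), s = {z | ∀ i ≤ n, z i = a i}}
  refine Measurable.measure_of_isPiSystem_of_isProbabilityMeasure (S := S) ?_ ?_ ?_
  · apply le_antisymm
    · refine iSup_le fun i => ?_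
      rintro _ ⟨t, -, rfl⟩
      have h : (fun z : ℕ → Step d => z i) ⁻¹' t =
          ⋃ h : {h : Π _ : Finset.Iic i, Step d // h ⟨i, by simp⟩ ∈ t},
            {z : ℕ → Step d | ∀ j ≤ i, z j = h.1 ⟨min j i, by simp⟩} := by
        ext z
        simp only [Set.mem_preimage, Set.mem_iUnion, Set.mem_ofPred_eq, Subtype.exists]
        constructor
        · exact fun hz => ⟨fun j => z j, hz, fun j hj => by simp [hj]⟩
        · rintro ⟨h, hh, hz⟩
          have := hz i le_rfl
          simp only [min_self] at this
          rwa [this]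
      rw [h]
      exact MeasurableSet.iUnion fun h =>
        MeasurableSpace.measurableSet_generateFrom ⟨i, fun j => h.1 ⟨min j i, by simp⟩, rfl⟩
    · refine MeasurableSpace.generateFrom_le ?_
      rintro _ ⟨n, a, rfl⟩
      have h : {z : ℕ → Step d | ∀ i ≤ n, z i = a i} =
          ⋂ i ∈ Finset.Iic n, (fun z : ℕ → Step d => z i) ⁻¹' {a i} := by
        ext z; simp
      rw [h]
      exact Finset.measurableSet_biInter _ fun i _ =>
        measurable_pi_apply i (measurableSet_singleton _)
  · rintro _ ⟨n, a, rfl⟩ _ ⟨m, b, rfl⟩ ⟨w, hw1, hw2⟩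
    refine ⟨max n m, w, ?_⟩
    ext z
    simp only [Set.mem_inter_iff, Set.mem_ofPred_eq, le_max_iff] at hw1 hw2 ⊢
    constructor
    · rintro ⟨h1, h2⟩ i (hi | hi)
      · rw [h1 i hi, hw1 i hi]
      · rw [h2 i hi, hw2 i hi]
    · intro h
      exact ⟨fun i hi => (h i (Or.inl hi)).trans (hw1 i hi),
        fun i hi => (h i (Or.inr hi)).trans (hw2 i hi)⟩
  · rintro _ ⟨n, a, rfl⟩
    simp_rw [quenchedMeasure_cylinder]
    refine Finset.measurable_fun_prod _ fun i _ => ENNReal.measurable_ofReal.comp ?_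
    exact (measurable_pi_apply (a i)).comp (measurable_subtype_coe.comp (measurable_pi_apply _))

/-- The quenched measures as a Markov kernel from environments to step sequences. -/
noncomputable def quenchedKernel (d : ℕ) : Kernel (Env d) (ℕ → Step d) :=
  ⟨quenchedMeasure, measurable_quenchedMeasure d⟩

instance (d : ℕ) : IsMarkovKernel (quenchedKernel d) :=
  ⟨fun ω => inferInstanceAs (IsProbabilityMeasure (quenchedMeasure ω))⟩

/-- The averaged measure `P_{o,o} = ℙ × P_{o,o}^ω` (semi-direct product) on `Ω × U^ℕ`. -/
noncomputable def averagedMeasure {d : ℕ} (ρ : Measure (LocalEnv d)) : Measure (EnvSteps d) :=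
  (envMeasure ρ) ⊗ₘ (quenchedKernel d)

instance {d : ℕ} (ρ : Measure (LocalEnv d)) [IsProbabilityMeasure ρ] :
    IsProbabilityMeasure (averagedMeasure ρ) := by
  unfold averagedMeasure; infer_instance

/-- The averaged transition vector `q(z) = 𝔼[π_{0,1}(0, z)]`. -/
noncomputable def meanStep {d : ℕ} (ρ : Measure (LocalEnv d)) (z : Step d) : ℝ :=
  ∫ ω, (ω (0, 0)).1 z ∂(envMeasure ρ)

/-- The logarithmic moment generating function `Λ_c(θ) = log ∑_{z ∈ U} q(z) e^{⟨θ, z⟩}`. -/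
noncomputable def logMGF {d : ℕ} (ρ : Measure (LocalEnv d)) (θ : EuclideanSpace ℝ (Fin d)) : ℝ :=
  Real.log (∑ z : Step d, meanStep ρ z * Real.exp (inner ℝ θ (toEuclid z.1)))

/-- The set `𝒟 = {ξ ∈ ℝ^d : |ξ_1| + ⋯ + |ξ_d| ≤ 1}` of possible mean velocities. -/
def velocitySet (d : ℕ) : Set (EuclideanSpace ℝ (Fin d)) := {ξ | ∑ i, |ξ i| ≤ 1}

/-- The local test functions: `f : Ω × U^ℕ → ℝ` is bounded, does not depend on the steps after the
`K`-th one, and is `𝓑_{-N}^+ ∩ 𝓑_M^-`-measurable in the environment for every step sequence. -/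
structure IsLocal {d : ℕ} (N M K : ℕ) (f : EnvSteps d → ℝ) : Prop where
  bounded : ∃ C : ℝ, ∀ p, |f p| ≤ C
  indep : ∀ (ω : Env d) (z z' : ℕ → Step d), (∀ i < K, z i = z' i) → f (ω, z) = f (ω, z')
  measurable : ∀ z : ℕ → Step d,
    Measurable[future d (-(N : ℤ)) ⊓ past d (M : ℤ)] fun ω => f (ω, z)

/-- The point `(T_{j,X_j} ω, (Z_{j+i})_{i ≥ 1})` of `Ω × U^ℕ`: the environment and the remaining
steps as seen from the walk at time `j`. -/
def seenAt {d : ℕ} (j : ℕ) (p : EnvSteps d) : EnvSteps d :=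
  (shift (j : ℤ) (pos p.2 j) p.1, fun i => p.2 (j + i))

/-- The empirical process `ν̄_{n,X}^∞`: the uniform distribution on the points `seenAt j`,
`0 ≤ j < n`. -/
noncomputable def empirical {d : ℕ} (n : ℕ) (p : EnvSteps d) : Measure (EnvSteps d) :=
  (n : ℝ≥0∞)⁻¹ • ∑ j ∈ Finset.range n, Measure.dirac (seenAt j p)

/-- `E_{o,o}[exp(⟨θ, X_L⟩ - L Λ_c(θ)) f(T_{N,X_N} ω, (Z_{N+i})_{i ≥ 1})]` with
`L = N + M + K + 1`. -/
noncomputable def tiltedExpectation {d : ℕ} (ρ : Measure (LocalEnv d))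
    (θ : EuclideanSpace ℝ (Fin d)) (N M K : ℕ) (f : EnvSteps d → ℝ) : ℝ :=
  ∫ p, Real.exp (inner ℝ θ (toEuclid (pos p.2 (N + M + K + 1)))
      - ((N + M + K + 1 : ℕ) : ℝ) * logMGF ρ θ) * f (seenAt N p) ∂(averagedMeasure ρ)

/-- `μ` is the measure `μ̄_ξ^∞` on `Ω × U^ℕ`: a probability measure that integrates each local test
function to its tilted expectation, with `θ` such that `∇Λ_c(θ) = ξ`. -/
structure IsTiltedMeasure {d : ℕ} (ρ : Measure (LocalEnv d)) (ξ : EuclideanSpace ℝ (Fin d))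
    (μ : Measure (EnvSteps d)) : Prop where
  isProbabilityMeasure : IsProbabilityMeasure μ
  integral_eq : ∃ θ : EuclideanSpace ℝ (Fin d), HasGradientAt (logMGF ρ) ξ θ ∧
    ∀ (N M K : ℕ) (f : EnvSteps d → ℝ), IsLocal N M K f →
      ∫ p, f p ∂μ = tiltedExpectation ρ θ N M K f

/-- The event `|X_n / n - ξ| ≤ δ`. -/
def velocityEvent {d : ℕ} (ξ : EuclideanSpace ℝ (Fin d)) (δ : ℝ) (n : ℕ) : Set (EnvSteps d) :=
  {p | ‖(n : ℝ)⁻¹ • toEuclid (pos p.2 n) - ξ‖ ≤ δ}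

/-- The event `|∫ f dν̄_{n,X}^∞ - ∫ f dμ| > ε`. -/
def deviationEvent {d : ℕ} (μ : Measure (EnvSteps d)) (f : EnvSteps d → ℝ) (ε : ℝ) (n : ℕ) :
    Set (EnvSteps d) :=
  {p | ε < |∫ y, f y ∂(empirical n p) - ∫ y, f y ∂μ|}

end SpaceTimeRWRE

open SpaceTimeRWRE

namespace SpaceTimeRWRE

/-! The walk meets every time level exactly once, and the levels are i.i.d. Recentre level `i` at
the position `X_i`, which depends only on earlier levels and steps, and pair it with the step taken
there; call this pair a site. The density `e^{⟨θ, X_n⟩ - n Λ_c(θ)}` is a product over steps, so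
under the tilted averaged measure the sites are i.i.d. (`map_sites_tilted`). Their law biases a
fresh column by `π(0, z) e^{⟨θ, z⟩ - Λ_c(θ)}`.

A local function of the environment and steps seen from the walker is a function of finitely many
consecutive sites. Hence the limit measure is the image of a two-sided product of site laws under
the map that rebuilds environment and steps. Averages against the empirical process become averages
of a bounded window function along an i.i.d. sequence, and Hoeffding's inequality gives exponential
concentration (`measure_abs_sum_window_gt_le`).

For the conditioning, choose `θ` so that the tilted walk has drift `ξ`. Such a `θ` exists because
`Λ_c(θ) - ⟨ξ, θ⟩` is coercive for `ξ` inside `𝒟`, and is unique by strict convexity. On `|X_n/n - ξ|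
≤ δ` the density is constant up to `e^{± n‖θ‖δ}`, and this event has tilted probability at least
`1/2` for large `n`. So conditional probabilities are at most `2 e^{2n‖θ‖δ}` times i.i.d. ones
(`eventually_cond_le`), and for small `δ` the Hoeffding rate wins. -/

/-! ### Columns, sites and the tilted site measure -/

/-- The environment on one time level. -/
abbrev Column (d : ℕ) : Type := (Fin d → ℤ) → LocalEnv d

/-- The environment on one time level together with the step taken there by the walk. -/
abbrev Site (d : ℕ) : Type := Column d × Step d

/-- The law of one time level of the environment. -/
noncomputable def columnMeasure {d : ℕ} (ρ : Measure (LocalEnv d)) : Measure (Column d) :=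
  Measure.infinitePi fun _ => ρ

instance {d : ℕ} (ρ : Measure (LocalEnv d)) [IsProbabilityMeasure ρ] :
    IsProbabilityMeasure (columnMeasure ρ) := by
  unfold columnMeasure; infer_instance

/-- The exponential weight `e^{⟨θ, z⟩ - Λ_c(θ)}` of one step. -/
noncomputable def stepWeight {d : ℕ} (ρ : Measure (LocalEnv d)) (θ : EuclideanSpace ℝ (Fin d))
    (z : Step d) : ℝ :=
  Real.exp (inner ℝ θ (toEuclid z.1) - logMGF ρ θ)

/-- The law of one time level, seen from the walker and tilted by `θ`, together with the step taken
there. -/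
noncomputable def siteMeasure {d : ℕ} (ρ : Measure (LocalEnv d)) (θ : EuclideanSpace ℝ (Fin d)) :
    Measure (Site d) :=
  ∑ z, ((columnMeasure ρ).withDensity
    fun c => ENNReal.ofReal ((c 0).1 z * stepWeight ρ θ z)).map fun c => (c, z)

variable {d : ℕ}

theorem stepWeight_pos (ρ : Measure (LocalEnv d)) (θ : EuclideanSpace ℝ (Fin d)) (z : Step d) :
    0 < stepWeight ρ θ z := Real.exp_pos _

theorem measurable_coord (z : Step d) : Measurable fun s : LocalEnv d => s.1 z :=
  (measurable_pi_apply z).comp measurable_subtype_coe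

theorem localEnv_nonneg (s : LocalEnv d) (z : Step d) : 0 ≤ s.1 z := s.2.1 z

theorem localEnv_le_one (s : LocalEnv d) (z : Step d) : s.1 z ≤ 1 := by
  rw [← s.2.2]
  exact Finset.single_le_sum (fun z _ => s.2.1 z) (Finset.mem_univ z)

theorem integrable_coord (ρ : Measure (LocalEnv d)) [IsProbabilityMeasure ρ] (z : Step d) :
    Integrable (fun s : LocalEnv d => s.1 z) ρ :=
  Integrable.of_mem_Icc 0 1 (measurable_coord z).aemeasurable
    (ae_of_all _ fun s => ⟨localEnv_nonneg s z, localEnv_le_one s z⟩)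

theorem meanStep_eq (ρ : Measure (LocalEnv d)) [IsProbabilityMeasure ρ] (z : Step d) :
    meanStep ρ z = ∫ s, s.1 z ∂ρ := by
  have h := Measure.infinitePi_map_eval (fun _ : ℤ × (Fin d → ℤ) => ρ) (0, 0)
  rw [meanStep, envMeasure]
  conv_rhs => rw [← h]
  exact (integral_map (φ := fun x : Env d => x (0, 0)) (measurable_pi_apply _).aemeasurable
    (measurable_coord z).aestronglyMeasurable).symm

theorem integral_column_zero (ρ : Measure (LocalEnv d)) [IsProbabilityMeasure ρ] (z : Step d) :
    ∫ c : Column d, (c 0).1 z ∂(columnMeasure ρ) = meanStep ρ z := by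
  have h := Measure.infinitePi_map_eval (fun _ : Fin d → ℤ => ρ) 0
  rw [meanStep_eq, columnMeasure]
  conv_rhs => rw [← h]
  exact (integral_map (φ := fun x : Column d => x 0) (measurable_pi_apply _).aemeasurable
    (measurable_coord z).aestronglyMeasurable).symm

theorem integrable_column_zero (ρ : Measure (LocalEnv d)) [IsProbabilityMeasure ρ] (z : Step d) :
    Integrable (fun c : Column d => (c 0).1 z) (columnMeasure ρ) :=
  Integrable.of_mem_Icc 0 1
    ((measurable_coord z).comp (measurable_pi_apply 0)).aemeasurable
    (ae_of_all _ fun c => ⟨localEnv_nonneg (c 0) z, localEnv_le_one (c 0) z⟩)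

theorem meanStep_nonneg (ρ : Measure (LocalEnv d)) (z : Step d) : 0 ≤ meanStep ρ z :=
  integral_nonneg fun _ => localEnv_nonneg _ z

theorem sum_meanStep (ρ : Measure (LocalEnv d)) [IsProbabilityMeasure ρ] :
    ∑ z, meanStep ρ z = 1 := by
  simp_rw [meanStep_eq]
  rw [← integral_finsetSum _ fun z _ => integrable_coord ρ z]
  simp_rw [fun s : LocalEnv d => s.2.2]
  simp

theorem sum_meanStep_exp_pos (ρ : Measure (LocalEnv d)) [IsProbabilityMeasure ρ]
    (θ : EuclideanSpace ℝ (Fin d)) :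
    0 < ∑ z : Step d, meanStep ρ z * Real.exp (inner ℝ θ (toEuclid z.1)) := by
  have h1 : (0 : ℝ) < ∑ z : Step d, meanStep ρ z := by rw [sum_meanStep]; norm_num
  obtain ⟨z, hz, hz'⟩ := Finset.exists_lt_of_sum_lt
    (f := fun _ : Step d => (0 : ℝ)) (s := Finset.univ) (by simpa using h1)
  exact Finset.sum_pos' (fun z _ => mul_nonneg (meanStep_nonneg ρ z) (Real.exp_pos _).le)
    ⟨z, hz, mul_pos hz' (Real.exp_pos _)⟩

theorem stepWeight_eq (ρ : Measure (LocalEnv d)) [IsProbabilityMeasure ρ]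
    (θ : EuclideanSpace ℝ (Fin d)) (z : Step d) :
    stepWeight ρ θ z = Real.exp (inner ℝ θ (toEuclid z.1)) /
      ∑ z : Step d, meanStep ρ z * Real.exp (inner ℝ θ (toEuclid z.1)) := by
  rw [stepWeight, Real.exp_sub, logMGF, Real.exp_log (sum_meanStep_exp_pos ρ θ)]

/-- Subtracting `Λ_c(θ)` is exactly the normalisation that gives the site law total mass one. -/
theorem sum_meanStep_stepWeight (ρ : Measure (LocalEnv d)) [IsProbabilityMeasure ρ]
    (θ : EuclideanSpace ℝ (Fin d)) : ∑ z, meanStep ρ z * stepWeight ρ θ z = 1 := by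
  simp_rw [stepWeight_eq, ← mul_div_assoc]
  rw [← Finset.sum_div, div_self (sum_meanStep_exp_pos ρ θ).ne']

theorem measurable_siteDensity (ρ : Measure (LocalEnv d)) (θ : EuclideanSpace ℝ (Fin d))
    (z : Step d) :
    Measurable fun c : Column d => ENNReal.ofReal ((c 0).1 z * stepWeight ρ θ z) :=
  ENNReal.measurable_ofReal.comp
    (((measurable_coord z).comp (measurable_pi_apply 0)).mul_const _)

theorem lintegral_siteMeasure (ρ : Measure (LocalEnv d)) (θ : EuclideanSpace ℝ (Fin d))
    {g : Site d → ℝ≥0∞} (hg : Measurable g) :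
    ∫⁻ a, g a ∂(siteMeasure ρ θ) = ∑ z, ∫⁻ c, ENNReal.ofReal ((c 0).1 z * stepWeight ρ θ z) *
      g (c, z) ∂(columnMeasure ρ) := by
  rw [siteMeasure, lintegral_finsetSum_measure]
  refine Finset.sum_congr rfl fun z _ => ?_
  rw [lintegral_map hg (by fun_prop), lintegral_withDensity_eq_lintegral_mul _
    (measurable_siteDensity ρ θ z) (by fun_prop)]
  rfl

theorem lintegral_siteDensity (ρ : Measure (LocalEnv d)) [IsProbabilityMeasure ρ]
    (θ : EuclideanSpace ℝ (Fin d)) (z : Step d) :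
    ∫⁻ c, ENNReal.ofReal ((c 0).1 z * stepWeight ρ θ z) ∂(columnMeasure ρ) =
      ENNReal.ofReal (meanStep ρ z * stepWeight ρ θ z) := by
  rw [← ofReal_integral_eq_lintegral_ofReal ((integrable_column_zero ρ z).mul_const _)
    (ae_of_all _ fun c => mul_nonneg (localEnv_nonneg _ _) (stepWeight_pos ρ θ z).le),
    integral_mul_const, integral_column_zero]

theorem siteMeasure_map_snd_lintegral (ρ : Measure (LocalEnv d)) [IsProbabilityMeasure ρ]
    (θ : EuclideanSpace ℝ (Fin d)) (g : Step d → ℝ≥0∞) :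
    ∫⁻ a, g a.2 ∂(siteMeasure ρ θ) =
      ∑ z, ENNReal.ofReal (meanStep ρ z * stepWeight ρ θ z) * g z := by
  rw [lintegral_siteMeasure (g := fun a => g a.2) ρ θ
    ((measurable_of_countable g).comp measurable_snd)]
  refine Finset.sum_congr rfl fun z _ => ?_
  dsimp only
  rw [lintegral_mul_const _ (measurable_siteDensity ρ θ z), lintegral_siteDensity]

instance (ρ : Measure (LocalEnv d)) [IsProbabilityMeasure ρ] (θ : EuclideanSpace ℝ (Fin d)) :
    IsProbabilityMeasure (siteMeasure ρ θ) := by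
  constructor
  have h := siteMeasure_map_snd_lintegral ρ θ fun _ => 1
  simp only [lintegral_one, mul_one] at h
  rw [h, ← ENNReal.ofReal_sum_of_nonneg
    fun z _ => mul_nonneg (meanStep_nonneg ρ z) (stepWeight_pos ρ θ z).le,
    sum_meanStep_stepWeight, ENNReal.ofReal_one]

theorem siteMeasure_map_snd (ρ : Measure (LocalEnv d)) [IsProbabilityMeasure ρ]
    (θ : EuclideanSpace ℝ (Fin d)) (z : Step d) :
    (siteMeasure ρ θ).map Prod.snd {z} = ENNReal.ofReal (meanStep ρ z * stepWeight ρ θ z) := by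
  classical
  have h := siteMeasure_map_snd_lintegral ρ θ (Set.indicator {z} 1)
  rw [Finset.sum_eq_single z (by intro b _ hb; simp [hb]) (by simp)] at h
  rw [← lintegral_indicator_one (measurableSet_singleton z),
    lintegral_map (measurable_of_countable _) measurable_snd, h]
  simp

theorem integral_siteMeasure_snd {E : Type*} [NormedAddCommGroup E] [NormedSpace ℝ E]
    [CompleteSpace E] (ρ : Measure (LocalEnv d)) [IsProbabilityMeasure ρ]
    (θ : EuclideanSpace ℝ (Fin d)) (g : Step d → E) :
    ∫ a, g a.2 ∂(siteMeasure ρ θ) = ∑ z, (meanStep ρ z * stepWeight ρ θ z) • g z := by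
  have : IsProbabilityMeasure ((siteMeasure ρ θ).map Prod.snd) :=
    Measure.isProbabilityMeasure_map measurable_snd.aemeasurable
  rw [← integral_map (φ := Prod.snd) (f := g) measurable_snd.aemeasurable
    (StronglyMeasurable.of_discrete.aestronglyMeasurable),
    integral_fintype Integrable.of_finite]
  refine Finset.sum_congr rfl fun z _ => ?_
  rw [Measure.real, siteMeasure_map_snd, ENNReal.toReal_ofReal
    (mul_nonneg (meanStep_nonneg ρ z) (stepWeight_pos ρ θ z).le)]

/-! ### The environment and the steps seen along the walk -/

/-- The time levels seen from the walker, together with the steps. -/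
def sites (p : EnvSteps d) (i : ℕ) : Site d := (fun x => p.1 (i, x + pos p.2 i), p.2 i)

theorem measurable_pos (i : ℕ) : Measurable fun z : ℕ → Step d => pos z i := by
  unfold pos
  exact Finset.measurable_sum _ fun j _ => measurable_subtype_coe.comp (measurable_pi_apply j)

/-- Evaluation of an environment at a measurable random place. -/
theorem measurable_env_apply {α ι : Type*} [MeasurableSpace α] [MeasurableSpace ι] [Countable ι]
    [MeasurableSingletonClass ι] {β : Type*} [MeasurableSpace β] {e : α → ι → β} {x : α → ι}
    (he : Measurable e) (hx : Measurable x) : Measurable fun a => e a (x a) := by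
  have h : Measurable fun q : (ι → β) × ι => q.1 q.2 :=
    measurable_from_prod_countable_left fun i => measurable_pi_apply i
  exact h.comp (he.prodMk hx)

theorem measurable_sites (i : ℕ) : Measurable fun p : EnvSteps d => sites p i := by
  unfold sites
  refine Measurable.prodMk (measurable_pi_lambda _ fun x => ?_)
    ((measurable_pi_apply i).comp measurable_snd)
  exact measurable_env_apply measurable_fst
    (measurable_const.prodMk (measurable_const.add ((measurable_pos i).comp measurable_snd)))

/-- Along a fixed path the columns of the environment are i.i.d. -/
theorem envMeasure_map_columns (ρ : Measure (LocalEnv d)) [IsProbabilityMeasure ρ] (L : ℕ)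
    (x : Fin L → Fin d → ℤ) :
    (envMeasure ρ).map (fun ω (i : Fin L) y => ω ((i : ℕ), y + x i)) =
      Measure.pi fun _ => columnMeasure ρ := by
  -- Distinct indices carry distinct times, and a translation within one level is injective, so no
  -- environment variable is used twice.
  have hinj : Function.Injective fun q : Fin L × (Fin d → ℤ) =>
      (((q.1 : ℕ) : ℤ), q.2 + x q.1) := by
    rintro ⟨i, y⟩ ⟨j, y'⟩ h
    simp only [Prod.mk.injEq, Nat.cast_inj] at h
    obtain ⟨h1, h2⟩ := h
    obtain rfl := Fin.ext h1
    simpa using h2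
  have h1 := Measure.map_infinitePi_infinitePi_of_inj
    (P := fun _ : ℤ × (Fin d → ℤ) => ρ) hinj
  have h2 := Measure.infinitePi_map_curry (fun (_ : Fin L) (_ : Fin d → ℤ) => ρ)
  rw [← h1, Measure.map_map (MeasurableEquiv.measurable _) (by fun_prop)] at h2
  rw [← Measure.infinitePi_eq_pi]
  exact h2

/-- A finite sequence continued periodically. -/
def periodize {α : Type*} {n : ℕ} (a : Fin (n + 1) → α) (i : ℕ) : α := a (Fin.ofNat (n + 1) i)

theorem periodize_val {α : Type*} {n : ℕ} (a : Fin (n + 1) → α) (i : Fin (n + 1)) :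
    periodize a i = a i := by
  simp [periodize]

/-- Periodic continuation turns a finite sequence into an infinite one without a default element;
only the entries below `n + 1` are ever used in earnest. -/
theorem periodize_restrict {α : Type*} {n : ℕ} (a : ℕ → α) {i : ℕ} (hi : i < n + 1) :
    periodize (fun j : Fin (n + 1) => a j) i = a i := by
  simp [periodize, Nat.mod_eq_of_lt hi]

theorem measurable_periodize {α : Type*} [MeasurableSpace α] {n : ℕ} :
    Measurable (periodize : (Fin (n + 1) → α) → ℕ → α) :=
  measurable_pi_lambda _ fun _ => measurable_pi_apply _

theorem lintegral_quenchedMeasure (ω : Env d) (n : ℕ) (g : (Fin (n + 1) → Step d) → ℝ≥0∞) :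
    ∫⁻ z, g (fun i => z i) ∂(quenchedMeasure ω) =
      ∑ a, g a * ∏ i : Fin (n + 1),
        ENNReal.ofReal ((ω (((i : ℕ) : ℤ), pos (periodize a) i)).1 (a i)) := by
  have hm : Measurable fun (z : ℕ → Step d) (i : Fin (n + 1)) => z i := by fun_prop
  rw [← lintegral_map (measurable_of_countable g) hm, lintegral_fintype]
  refine Finset.sum_congr rfl fun a _ => ?_
  rw [Measure.map_apply hm (measurableSet_singleton _)]
  have hset : (fun (z : ℕ → Step d) (i : Fin (n + 1)) => z i) ⁻¹' {a} =
      {z | ∀ i ≤ n, z i = periodize a i} := by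
    ext z
    simp only [Set.mem_preimage, Set.mem_singleton_iff, funext_iff, Set.mem_ofPred_eq]
    constructor
    · intro h i hi
      have := h ⟨i, by omega⟩
      rw [← periodize_val a ⟨i, by omega⟩] at this
      exact this
    · intro h i
      rw [h i (by omega), periodize_val]
  rw [hset, quenchedMeasure_cylinder, Finset.prod_range]
  simp_rw [periodize_val]

theorem pos_congr {z z' : ℕ → Step d} {n : ℕ} (h : ∀ i < n, z i = z' i) : pos z n = pos z' n :=
  Finset.sum_congr rfl fun i hi => by rw [h i (Finset.mem_range.1 hi)]

theorem toEuclid_sum {ι : Type*} (s : Finset ι) (x : ι → Fin d → ℤ) :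
    toEuclid (∑ i ∈ s, x i) = ∑ i ∈ s, toEuclid (x i) := by
  ext j
  simp [toEuclid]

/-- The tilt is multiplicative because `X_n` is a sum of steps; this is the source of the
independence of the sites. -/
theorem exp_tilt_eq_prod (ρ : Measure (LocalEnv d)) (θ : EuclideanSpace ℝ (Fin d))
    (z : ℕ → Step d) (n : ℕ) :
    Real.exp (inner ℝ θ (toEuclid (pos z n)) - (n : ℝ) * logMGF ρ θ) =
      ∏ i ∈ Finset.range n, stepWeight ρ θ (z i) := by
  unfold stepWeight
  rw [← Real.exp_sum, Finset.sum_sub_distrib, pos, toEuclid_sum, inner_sum]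
  simp

/-- The density of the tilted walk up to time `n`. -/
noncomputable def tiltDensity (ρ : Measure (LocalEnv d)) (θ : EuclideanSpace ℝ (Fin d)) (n : ℕ)
    (p : EnvSteps d) : ℝ :=
  Real.exp (inner ℝ θ (toEuclid (pos p.2 n)) - (n : ℝ) * logMGF ρ θ)

theorem measurable_tiltDensity (ρ : Measure (LocalEnv d)) (θ : EuclideanSpace ℝ (Fin d)) (n : ℕ) :
    Measurable (tiltDensity ρ θ n) := by
  have h : Measurable fun x : Fin d → ℤ =>
      Real.exp (inner ℝ θ (toEuclid x) - (n : ℝ) * logMGF ρ θ) := measurable_of_countable _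
  exact h.comp ((measurable_pos n).comp measurable_snd)

/-- Under the tilted averaged measure, the time levels seen from the walker and the steps are
i.i.d. -/
theorem map_sites_tilted (ρ : Measure (LocalEnv d)) [IsProbabilityMeasure ρ]
    (θ : EuclideanSpace ℝ (Fin d)) (n : ℕ) :
    ((averagedMeasure ρ).withDensity fun p => ENNReal.ofReal (tiltDensity ρ θ (n + 1) p)).map
      (fun p (i : Fin (n + 1)) => sites p i) = Measure.pi fun _ => siteMeasure ρ θ := by
  classical
  have hsites : Measurable fun (p : EnvSteps d) (i : Fin (n + 1)) => sites p i :=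
    measurable_pi_lambda _ fun i => measurable_sites i
  have hdens : Measurable fun p : EnvSteps d => ENNReal.ofReal (tiltDensity ρ θ (n + 1) p) :=
    ENNReal.measurable_ofReal.comp (measurable_tiltDensity ρ θ _)
  refine (Measure.pi_eq fun t ht => ?_).symm
  have hind : ∀ i, Measurable ((t i).indicator (1 : Site d → ℝ≥0∞)) := fun i =>
    measurable_one.indicator (ht i)
  rw [Measure.map_apply hsites (MeasurableSet.univ_pi ht),
    withDensity_apply _ (hsites (MeasurableSet.univ_pi ht)), averagedMeasure,
    ← lintegral_indicator (hsites (MeasurableSet.univ_pi ht)),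
    Measure.lintegral_compProd (hdens.indicator (hsites (MeasurableSet.univ_pi ht)))]
  let path (a : Fin (n + 1) → Step d) (i : Fin (n + 1)) : Fin d → ℤ := pos (periodize a) i
  let col (a : Fin (n + 1) → Step d) (ω : Env d) (i : Fin (n + 1)) : Column d :=
    fun y => ω (((i : ℕ) : ℤ), y + path a i)
  -- Once the path `a` is fixed, quenched probability, tilt and indicator combine into one factor
  -- per time level. The jump probability is read at the origin of the recentred column.
  let G (a : Fin (n + 1) → Step d) (c : Fin (n + 1) → Column d) : ℝ≥0∞ :=
    ∏ i, (ENNReal.ofReal ((c i 0).1 (a i) * stepWeight ρ θ (a i)) *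
      (t i).indicator 1 (c i, a i))
  have hfac : ∀ (a : Fin (n + 1) → Step d) (i : Fin (n + 1)), Measurable fun c : Column d =>
      ENNReal.ofReal ((c 0).1 (a i) * stepWeight ρ θ (a i)) * (t i).indicator 1 (c, a i) :=
    fun a i => (measurable_siteDensity ρ θ (a i)).mul ((hind i).comp (by fun_prop))
  have hG : ∀ a, Measurable (G a) := fun a =>
    Finset.measurable_fun_prod _ fun i _ => (hfac a i).comp (measurable_pi_apply i)
  have hcol : ∀ a, Measurable (col a) := fun a => by fun_prop
  have hq : ∀ ω : Env d, ∫⁻ z, ((fun (p : EnvSteps d) (i : Fin (n + 1)) => sites p i) ⁻¹'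
      Set.univ.pi t).indicator (fun p => ENNReal.ofReal (tiltDensity ρ θ (n + 1) p)) (ω, z)
        ∂(quenchedKernel d ω) = ∑ a, G a (col a ω) := by
    intro ω
    change ∫⁻ z, _ ∂(quenchedMeasure ω) = _
    have h1 : ∀ z : ℕ → Step d, ((fun (p : EnvSteps d) (i : Fin (n + 1)) => sites p i) ⁻¹'
        Set.univ.pi t).indicator (fun p => ENNReal.ofReal (tiltDensity ρ θ (n + 1) p)) (ω, z) =
        (fun a : Fin (n + 1) → Step d => ∏ i, (ENNReal.ofReal (stepWeight ρ θ (a i)) *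
          (t i).indicator 1 (col a ω i, a i))) (fun i => z i) := by
      intro z
      have hp : ∀ i : Fin (n + 1), sites (ω, z) i =
          (col (fun i => z i) ω i, (fun i : Fin (n + 1) => z i) i) := by
        intro i
        simp only [sites, col, path]
        rw [pos_congr (z := z) (z' := periodize fun i : Fin (n + 1) => z i)]
        intro j hj
        rw [periodize_restrict z (by omega)]
      beta_reduce
      rw [Finset.prod_mul_distrib, ← ENNReal.ofReal_prod_of_nonneg
        fun i _ => (stepWeight_pos ρ θ _).le]
      have hd : tiltDensity ρ θ (n + 1) (ω, z) =
          ∏ i : Fin (n + 1), stepWeight ρ θ (z i) := by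
        rw [tiltDensity, exp_tilt_eq_prod, Finset.prod_range]
      by_cases hmem : ∀ i : Fin (n + 1), sites (ω, z) i ∈ t i
      · rw [Set.indicator_of_mem (by simpa using hmem), hd]
        have h1 : ∏ i, (t i).indicator (1 : Site d → ℝ≥0∞) (col (fun i => z i) ω i, z i) = 1 :=
          Finset.prod_eq_one fun i _ => by
            rw [← hp, Set.indicator_of_mem (hmem i), Pi.one_apply]
        rw [h1, mul_one]
      · rw [Set.indicator_of_notMem (by simpa using hmem)]
        push Not at hmem
        obtain ⟨i, hi⟩ := hmem
        have h1 : ∏ i, (t i).indicator (1 : Site d → ℝ≥0∞) (col (fun i => z i) ω i, z i) = 0 :=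
          Finset.prod_eq_zero (Finset.mem_univ i) (by rw [← hp, Set.indicator_of_notMem hi])
        rw [h1, mul_zero]
    simp_rw [h1]
    rw [lintegral_quenchedMeasure ω n fun a : Fin (n + 1) → Step d => ∏ i,
      (ENNReal.ofReal (stepWeight ρ θ (a i)) * (t i).indicator 1 (col a ω i, a i))]
    refine Finset.sum_congr rfl fun a _ => ?_
    rw [← Finset.prod_mul_distrib]
    refine Finset.prod_congr rfl fun i _ => ?_
    rw [ENNReal.ofReal_mul (localEnv_nonneg _ _)]
    simp only [col, path, zero_add]
    ring
  simp_rw [hq]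
  rw [lintegral_finsetSum _ fun a _ => show Measurable fun ω => G a (col a ω) from (hG a).comp (hcol a)]
  -- Along a deterministic path the recentred columns are i.i.d., so the expectation of the product
  -- splits.
  have hint : ∀ a, ∫⁻ ω, G a (col a ω) ∂(envMeasure ρ) = ∏ i,
      ∫⁻ c, ENNReal.ofReal ((c 0).1 (a i) * stepWeight ρ θ (a i)) *
        (t i).indicator 1 (c, a i) ∂(columnMeasure ρ) := by
    intro a
    rw [← lintegral_map (hG a) (hcol a), envMeasure_map_columns ρ (n + 1) (path a)]
    have hindep := iIndepFun_pi (μ := fun _ : Fin (n + 1) => columnMeasure ρ)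
      fun i => (hfac a i).aemeasurable
    rw [lintegral_prod_eq_prod_lintegral_of_indepFun _ _ hindep
      fun i => (hfac a i).comp (measurable_pi_apply i)]
    refine Finset.prod_congr rfl fun i _ => ?_
    exact (measurePreserving_eval (fun _ : Fin (n + 1) => columnMeasure ρ) i).lintegral_comp
      (hfac a i)
  simp_rw [hint]
  have hs : ∀ i, siteMeasure ρ θ (t i) = ∑ z, ∫⁻ c,
      ENNReal.ofReal ((c 0).1 z * stepWeight ρ θ z) * (t i).indicator 1 (c, z)
        ∂(columnMeasure ρ) := by
    intro i
    rw [← lintegral_siteMeasure ρ θ (hind i), lintegral_indicator_one (ht i)]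
  simp_rw [hs]
  -- Expanding the product over times of sums over steps gives the sum over all paths.
  rw [Finset.prod_univ_sum, Fintype.piFinset_univ]

/-! ### Local functions -/

/-- A function measurable with respect to the σ-algebra generated by a family of coordinates depends
on these coordinates only. -/
theorem eq_of_measurable_iSup_comap {ι β : Type*} {α : ι → Type*} [∀ i, MeasurableSpace (α i)]
    [MeasurableSpace β] [MeasurableSingletonClass β] {s : ι → Prop} {g : (∀ i, α i) → β}
    (hg : Measurable[⨆ i : {i // s i}, MeasurableSpace.comap (fun ω => ω i.1) inferInstance] g)
    {ω ω' : ∀ i, α i} (h : ∀ i, s i → ω i = ω' i) : g ω = g ω' := by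
  have hle : (⨆ i : {i // s i}, MeasurableSpace.comap
      (fun ω : ∀ i, α i => ω i.1) inferInstance) ≤
      MeasurableSpace.comap (fun (ω : ∀ i, α i) (i : {i // s i}) => ω i.1) inferInstance := by
    refine iSup_le fun i => ?_
    rintro _ ⟨t, ht, rfl⟩
    exact ⟨(fun x : ∀ i : {i // s i}, α i.1 => x i) ⁻¹' t, measurable_pi_apply i ht, rfl⟩
  -- The fibre of `g` through `ω` is the preimage of a set of restricted configurations, so it
  -- contains every `ω'` with the same restriction.
  obtain ⟨t, -, ht⟩ := hle _ (hg (measurableSet_singleton (g ω)))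
  have h1 : ω' ∈ g ⁻¹' {g ω} := by
    rw [← ht]
    have h2 : ω ∈ g ⁻¹' {g ω} := rfl
    rw [← ht] at h2
    have h3 : (fun i : {i // s i} => ω' i.1) = fun i : {i // s i} => ω i.1 :=
      funext fun i => (h i.1 i.2).symm
    simpa only [Set.mem_preimage, h3] using h2
  exact (Set.mem_singleton_iff.1 h1).symm

theorem past_le (n : ℤ) : past d n ≤ (inferInstance : MeasurableSpace (Env d)) :=
  iSup_le fun p => (measurable_pi_apply p.1).comap_le

namespace IsLocal

variable {N M K : ℕ} {f : EnvSteps d → ℝ}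

theorem congr (hf : IsLocal N M K f) {p p' : EnvSteps d}
    (hω : ∀ q : ℤ × (Fin d → ℤ), -(N : ℤ) ≤ q.1 → q.1 ≤ M → p.1 q = p'.1 q)
    (hz : ∀ i < K, p.2 i = p'.2 i) : f p = f p' := by
  obtain ⟨ω, z⟩ := p
  obtain ⟨ω', z'⟩ := p'
  rw [hf.indep ω z z' hz]
  -- The hybrid follows `ω` up to time `M` and `ω'` afterwards: past-measurability compares it with
  -- `ω`, future-measurability with `ω'`.
  let ω'' : Env d := fun q => if q.1 ≤ M then ω q else ω' q
  have h1 : f (ω, z') = f (ω'', z') :=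
    eq_of_measurable_iSup_comap (s := fun q : ℤ × (Fin d → ℤ) => q.1 ≤ (M : ℤ))
      ((hf.measurable z').mono inf_le_right le_rfl) fun q hq => by simp [ω'', hq]
  have h2 : f (ω'', z') = f (ω', z') :=
    eq_of_measurable_iSup_comap (s := fun q : ℤ × (Fin d → ℤ) => -(N : ℤ) ≤ q.1)
      ((hf.measurable z').mono inf_le_left le_rfl) fun q hq => by
        by_cases h : q.1 ≤ M
        · simpa [ω'', h] using hω q hq h
        · simp [ω'', h]
  exact h1.trans h2

theorem measurable_fun (hf : IsLocal N M K f) : Measurable f := by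
  rcases isEmpty_or_nonempty (Step d) with hs | ⟨⟨z₀⟩⟩
  · have : IsEmpty (EnvSteps d) := ⟨fun p => hs.false (p.2 0)⟩
    exact measurable_of_empty f
  -- The steps after the `K`-th are filled with an arbitrary `z₀`; what remains is a finite step
  -- variable, so measurability in the environment alone gives joint measurability.
  let ext (u : Fin K → Step d) (i : ℕ) : Step d := if h : i < K then u ⟨i, h⟩ else z₀
  have h1 : Measurable fun q : Env d × (Fin K → Step d) => f (q.1, ext q.2) :=
    measurable_from_prod_countable_left fun u =>
      (hf.measurable (ext u)).mono (inf_le_right.trans (past_le _)) le_rfl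
  have h2 : f = (fun q : Env d × (Fin K → Step d) => f (q.1, ext q.2)) ∘
      fun p : EnvSteps d => (p.1, fun i : Fin K => p.2 i) := by
    funext p
    exact hf.indep p.1 _ _ fun i hi => by simp [ext, hi]
  rw [h2]
  exact h1.comp (by fun_prop)

end IsLocal

/-! ### Reconstruction of the environment from the sites -/

/-- The environment and the steps seen from the walker at time `N`, recovered from the sites
visited from time `0` on. -/
def unview (N : ℕ) (a : ℕ → Site d) : EnvSteps d :=
  (fun q => (a (q.1 + N).toNat).1
      (q.2 + pos (fun i => (a i).2) N - pos (fun i => (a i).2) (q.1 + N).toNat),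
    fun i => (a (N + i)).2)

theorem measurable_unview (N : ℕ) : Measurable (unview N : (ℕ → Site d) → EnvSteps d) := by
  have hp : ∀ n, Measurable fun a : ℕ → Site d => pos (fun i => (a i).2) n := fun n =>
    (measurable_pos n).comp (measurable_pi_lambda _ fun i => (measurable_pi_apply i).snd)
  refine Measurable.prodMk (measurable_pi_lambda _ fun q => ?_)
    (measurable_pi_lambda _ fun i => (measurable_pi_apply (N + i)).snd)
  exact measurable_env_apply (measurable_pi_apply (q.1 + N).toNat).fst
    ((measurable_const.add (hp N)).sub (hp _))

theorem pos_add (z : ℕ → Step d) (j m : ℕ) :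
    pos z (j + m) = pos z j + pos (fun i => z (j + i)) m :=
  Finset.sum_range_add _ j m

namespace IsLocal

variable {N M K : ℕ} {f : EnvSteps d → ℝ}

/-- The levels `-N, …, M` and the first `K` steps seen at time `N` involve only sites below `N + M +
K + 1`, the time horizon of the tilt. -/
theorem unview_congr (hf : IsLocal N M K f) {a a' : ℕ → Site d}
    (h : ∀ i < N + M + K + 1, a i = a' i) : f (unview N a) = f (unview N a') := by
  have hp : ∀ m ≤ N + M, pos (fun i => (a i).2) m = pos (fun i => (a' i).2) m := fun m hm =>
    pos_congr fun i hi => by rw [h i (by omega)]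
  refine hf.congr (fun q h1 h2 => ?_) fun i hi => ?_
  · simp only [unview]
    rw [h _ (by omega), hp _ (by omega), hp _ (by omega)]
  · simp only [unview]
    rw [h _ (by omega)]

/-- Reconstruction uses only position differences, so the common offset `X_j` cancels. The view at
time `j + N` is therefore the same function of the sites from time `j` on, for every `j`. -/
theorem seenAt_add (hf : IsLocal N M K f) (j : ℕ) (p : EnvSteps d) :
    f (seenAt (j + N) p) = f (unview N fun i => sites p (j + i)) := by
  refine hf.congr (fun q h1 h2 => ?_) fun i hi => ?_
  · obtain ⟨m, hm⟩ : ∃ m : ℕ, q.1 + N = m := ⟨(q.1 + N).toNat, by omega⟩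
    simp only [seenAt, shift, unview, sites, hm, Int.toNat_natCast]
    refine congrArg p.1 (Prod.ext ?_ ?_)
    · push_cast
      omega
    · simp only [pos_add]
      abel
  · simp only [seenAt, unview, sites, add_assoc]

end IsLocal

/-- A local function, as a function of the window of sites that it depends on. -/
def windowFun (N M K : ℕ) (f : EnvSteps d → ℝ) (b : Fin (N + M + K + 1) → Site d) : ℝ :=
  f (unview N (periodize b))

namespace IsLocal

variable {N M K : ℕ} {f : EnvSteps d → ℝ}

theorem unview_eq (hf : IsLocal N M K f) (a : ℕ → Site d) :
    f (unview N a) = windowFun N M K f fun i => a i :=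
  hf.unview_congr fun _ hi => (periodize_restrict a hi).symm

theorem measurable_windowFun (hf : IsLocal N M K f) : Measurable (windowFun N M K f) :=
  hf.measurable_fun.comp ((measurable_unview N).comp measurable_periodize)

theorem tiltedExpectation_eq (hf : IsLocal N M K f) (ρ : Measure (LocalEnv d))
    [IsProbabilityMeasure ρ] (θ : EuclideanSpace ℝ (Fin d)) :
    tiltedExpectation ρ θ N M K f =
      ∫ b, windowFun N M K f b ∂(Measure.pi fun _ => siteMeasure ρ θ) := by
  have hD : Measurable fun p : EnvSteps d =>
      ENNReal.ofReal (tiltDensity ρ θ (N + M + K + 1) p) :=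
    ENNReal.measurable_ofReal.comp (measurable_tiltDensity ρ θ _)
  rw [← map_sites_tilted, integral_map (φ := fun p (i : Fin (N + M + K + 1)) => sites p i)
    (measurable_pi_lambda (fun p (i : Fin (N + M + K + 1)) => sites p i)
      fun i => measurable_sites i).aemeasurable
    hf.measurable_windowFun.aestronglyMeasurable,
    integral_withDensity_eq_integral_toReal_smul hD
      (ae_of_all _ fun _ => ENNReal.ofReal_lt_top), tiltedExpectation]
  refine integral_congr_ae (ae_of_all _ fun p => ?_)
  have h := hf.seenAt_add 0 p
  rw [hf.unview_eq] at h
  simp only [zero_add] at h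
  simp only [h]
  rw [tiltDensity, ENNReal.toReal_ofReal (Real.exp_pos _).le, smul_eq_mul]

end IsLocal

/-! ### The tilted measure -/

/-- The position at time `n ∈ ℤ` of the two-sided walk that is at the origin at time `0`. -/
def twoSidedPos (z : ℤ → Step d) : ℤ → Fin d → ℤ
  | Int.ofNat n => ∑ i ∈ Finset.range n, (z i).1
  | Int.negSucc n => -∑ i ∈ Finset.range (n + 1), (z (Int.negSucc i)).1

theorem twoSidedPos_succ (z : ℤ → Step d) (n : ℤ) :
    twoSidedPos z (n + 1) = twoSidedPos z n + (z n).1 := by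
  match n with
  | Int.ofNat n => exact Finset.sum_range_succ _ n
  | Int.negSucc 0 =>
    change ∑ i ∈ Finset.range 0, (z i).1 =
      -∑ i ∈ Finset.range 1, (z (Int.negSucc i)).1 + (z (Int.negSucc 0)).1
    simp
  | Int.negSucc (n + 1) =>
    have h : Int.negSucc (n + 1) + 1 = Int.negSucc n := by omega
    rw [h]
    simp only [twoSidedPos]
    rw [Finset.sum_range_succ _ (n + 1)]
    abel

/-- The two-sided path seen from time `-N` is a one-sided path up to a constant, which is fixed by
the value `0` at time `0`, that is, at `m = N`. -/
theorem twoSidedPos_sub (z : ℤ → Step d) (N m : ℕ) :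
    twoSidedPos z ((m : ℤ) - N) =
      pos (fun i => z ((i : ℤ) - N)) m - pos (fun i => z ((i : ℤ) - N)) N := by
  have h : ∀ m : ℕ, twoSidedPos z ((m : ℤ) - N) =
      twoSidedPos z (-N) + pos (fun i => z ((i : ℤ) - N)) m := by
    intro m
    induction m with
    | zero => simp [pos]
    | succ m ih =>
      have h1 : ((m + 1 : ℕ) : ℤ) - N = (m : ℤ) - N + 1 := by push_cast; ring
      rw [h1, twoSidedPos_succ, ih, pos, pos, Finset.sum_range_succ, add_assoc]
  have h0 := h N
  rw [sub_self] at h0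
  have h1 : twoSidedPos z 0 = 0 := Finset.sum_range_zero _
  rw [h1] at h0
  rw [h m, eq_neg_of_add_eq_zero_left h0.symm]
  abel

theorem measurable_twoSidedPos (n : ℤ) : Measurable fun z : ℤ → Step d => twoSidedPos z n := by
  match n with
  | Int.ofNat n =>
    exact Finset.measurable_sum _ fun j _ => measurable_subtype_coe.comp (measurable_pi_apply _)
  | Int.negSucc n =>
    exact (Finset.measurable_sum _ fun j _ =>
      measurable_subtype_coe.comp (measurable_pi_apply _)).neg

/-- The environment and the steps recovered from a two-sided sequence of sites. -/
def twoSidedView (a : ℤ → Site d) : EnvSteps d :=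
  (fun q => (a q.1).1 (q.2 - twoSidedPos (fun i => (a i).2) q.1), fun i => (a i).2)

theorem measurable_twoSidedView : Measurable (twoSidedView : (ℤ → Site d) → EnvSteps d) := by
  refine Measurable.prodMk (measurable_pi_lambda _ fun q => ?_)
    (measurable_pi_lambda _ fun i => (measurable_pi_apply (i : ℤ)).snd)
  exact measurable_env_apply (measurable_pi_apply q.1).fst
    (measurable_const.sub ((measurable_twoSidedPos q.1).comp
      (measurable_pi_lambda _ fun i => (measurable_pi_apply i).snd)))

theorem IsLocal.twoSidedView_eq {N M K : ℕ} {f : EnvSteps d → ℝ} (hf : IsLocal N M K f)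
    (a : ℤ → Site d) :
    f (twoSidedView a) = windowFun N M K f fun i => a (((i : ℕ) : ℤ) - N) := by
  rw [← hf.unview_eq fun i => a ((i : ℤ) - N)]
  refine hf.congr (fun q h1 h2 => ?_) fun i hi => ?_
  · obtain ⟨m, hm⟩ : ∃ m : ℕ, q.1 + N = m := ⟨(q.1 + N).toNat, by omega⟩
    obtain ⟨n, x⟩ := q
    obtain rfl : n = (m : ℤ) - N := by simp only at hm; omega
    simp only [unview, twoSidedView, hm, Int.toNat_natCast, twoSidedPos_sub]
    exact congrArg (a _).1 (by abel)
  · simp only [unview, twoSidedView]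
    congr 2
    push_cast
    omega

/-- The law of the environment and the steps seen from the stationary two-sided tilted walk. -/
noncomputable def tiltedMeasure (ρ : Measure (LocalEnv d)) (θ : EuclideanSpace ℝ (Fin d)) :
    Measure (EnvSteps d) :=
  (Measure.infinitePi fun _ : ℤ => siteMeasure ρ θ).map twoSidedView

instance (ρ : Measure (LocalEnv d)) [IsProbabilityMeasure ρ] (θ : EuclideanSpace ℝ (Fin d)) :
    IsProbabilityMeasure (tiltedMeasure ρ θ) :=
  Measure.isProbabilityMeasure_map measurable_twoSidedView.aemeasurable

theorem IsLocal.integral_tiltedMeasure {N M K : ℕ} {f : EnvSteps d → ℝ} (hf : IsLocal N M K f)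
    (ρ : Measure (LocalEnv d)) [IsProbabilityMeasure ρ] (θ : EuclideanSpace ℝ (Fin d)) :
    ∫ p, f p ∂(tiltedMeasure ρ θ) =
      ∫ b, windowFun N M K f b ∂(Measure.pi fun _ => siteMeasure ρ θ) := by
  have hinj : Function.Injective fun i : Fin (N + M + K + 1) => ((i : ℕ) : ℤ) - N := by
    intro i j h
    exact Fin.ext (by simpa using h)
  have h := Measure.map_infinitePi_infinitePi_of_inj (P := fun _ : ℤ => siteMeasure ρ θ) hinj
  rw [← Measure.infinitePi_eq_pi, ← h, tiltedMeasure,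
    integral_map measurable_twoSidedView.aemeasurable hf.measurable_fun.aestronglyMeasurable,
    integral_map (φ := fun (ω : ℤ → Site d) (i : Fin (N + M + K + 1)) => ω (((i : ℕ) : ℤ) - N))
      (measurable_pi_lambda _ fun i : Fin (N + M + K + 1) =>
        measurable_pi_apply (((i : ℕ) : ℤ) - N)).aemeasurable
      hf.measurable_windowFun.aestronglyMeasurable]
  simp_rw [hf.twoSidedView_eq]

/-- Both integrals equal that of the window function against a finite product of site laws. -/
theorem isTiltedMeasure_tiltedMeasure (ρ : Measure (LocalEnv d)) [IsProbabilityMeasure ρ]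
    {ξ θ : EuclideanSpace ℝ (Fin d)} (hθ : HasGradientAt (logMGF ρ) ξ θ) :
    IsTiltedMeasure ρ ξ (tiltedMeasure ρ θ) :=
  ⟨inferInstance, θ, hθ, fun N M K f hf => by
    rw [hf.integral_tiltedMeasure, hf.tiltedExpectation_eq]⟩

/-! ### Uniqueness -/

theorem measurable_past_eval {n : ℤ} {p : ℤ × (Fin d → ℤ)} (hp : p.1 ≤ n) :
    Measurable[past d n] fun ω : Env d => ω p :=
  Measurable.of_comap_le (le_iSup (fun p : {p : ℤ × (Fin d → ℤ) // p.1 ≤ n} =>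
    MeasurableSpace.comap (fun ω : Env d => ω p.1) inferInstance) ⟨p, hp⟩)

theorem measurable_future_eval {n : ℤ} {p : ℤ × (Fin d → ℤ)} (hp : n ≤ p.1) :
    Measurable[future d n] fun ω : Env d => ω p :=
  Measurable.of_comap_le (le_iSup (fun p : {p : ℤ × (Fin d → ℤ) // n ≤ p.1} =>
    MeasurableSpace.comap (fun ω : Env d => ω p.1) inferInstance) ⟨p, hp⟩)

/-- A cylinder involves finitely many times and steps. Such sets form a generating π-system, so
local functions separate probability measures. -/
theorem isLocal_indicator_cylinder (s : Finset (ℤ × (Fin d → ℤ)))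
    {B : ℤ × (Fin d → ℤ) → Set (LocalEnv d)} (hB : ∀ p ∈ s, MeasurableSet (B p))
    (u : Finset ℕ) (D : ℕ → Set (Step d)) :
    ∃ N M K : ℕ, IsLocal N M K
      ((((s : Set (ℤ × (Fin d → ℤ))).pi B) ×ˢ ((u : Set ℕ).pi D)).indicator fun _ => (1 : ℝ)) := by
  classical
  obtain ⟨R, hR⟩ : ∃ R : ℕ, ∀ p ∈ s, p.1.natAbs ≤ R :=
    ⟨s.sup fun p => p.1.natAbs, fun p hp => Finset.le_sup (f := fun p => p.1.natAbs) hp⟩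
  obtain ⟨K, hK⟩ : ∃ K : ℕ, ∀ i ∈ u, i < K :=
    ⟨u.sup id + 1, fun i hi => Nat.lt_succ_of_le (Finset.le_sup (f := id) hi)⟩
  refine ⟨R, R, K, ⟨1, fun p => ?_⟩, fun ω z z' hz => ?_, fun z => ?_⟩
  · rw [Set.indicator_apply]
    split_ifs <;> simp
  · have h : z ∈ (u : Set ℕ).pi D ↔ z' ∈ (u : Set ℕ).pi D := by
      simp only [Set.mem_pi, Finset.mem_coe]
      exact forall₂_congr fun i hi => by rw [hz i (hK i hi)]
    simp only [Set.indicator_apply, Set.mem_prod, h]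
  · have hS : MeasurableSet[future d (-(R : ℤ)) ⊓ past d (R : ℤ)]
        ((s : Set (ℤ × (Fin d → ℤ))).pi B) := by
      refine MeasurableSpace.measurableSet_inf.2 ?_
      have hpi : ((s : Set (ℤ × (Fin d → ℤ))).pi B) =
          ⋂ p ∈ s, (fun ω : Env d => ω p) ⁻¹' B p := by
        ext ω; simp
      rw [hpi]
      constructor
      · refine Finset.measurableSet_biInter _ fun p hp => measurable_future_eval ?_ (hB p hp)
        have := hR p hp
        omega
      · refine Finset.measurableSet_biInter _ fun p hp => measurable_past_eval ?_ (hB p hp)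
        have := hR p hp
        omega
    by_cases hz : z ∈ (u : Set ℕ).pi D
    · have h : (fun ω : Env d => (((s : Set (ℤ × (Fin d → ℤ))).pi B) ×ˢ
          ((u : Set ℕ).pi D)).indicator (fun _ => (1 : ℝ)) (ω, z)) =
          ((s : Set (ℤ × (Fin d → ℤ))).pi B).indicator fun _ => 1 := by
        funext ω
        simp [Set.indicator_apply, hz]
      rw [h]
      exact measurable_const.indicator hS
    · have h : (fun ω : Env d => (((s : Set (ℤ × (Fin d → ℤ))).pi B) ×ˢ
          ((u : Set ℕ).pi D)).indicator (fun _ => (1 : ℝ)) (ω, z)) = fun _ => 0 := by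
        funext ω
        simp [hz]
      rw [h]
      exact measurable_const

/-- A probability measure on `Ω × U^ℕ` is determined by the integrals of the local functions. -/
theorem ext_of_integral_isLocal {μ ν : Measure (EnvSteps d)} [IsProbabilityMeasure μ]
    [IsProbabilityMeasure ν]
    (h : ∀ (N M K : ℕ) (f : EnvSteps d → ℝ), IsLocal N M K f → ∫ p, f p ∂μ = ∫ p, f p ∂ν) :
    μ = ν := by
  let C : Set (Set (Env d)) := squareCylinders fun _ => {s | MeasurableSet s}
  let D : Set (Set (ℕ → Step d)) := squareCylinders fun _ => {s | MeasurableSet s}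
  have hC : MeasurableSpace.generateFrom C = MeasurableSpace.pi := generateFrom_squareCylinders
  have hD : MeasurableSpace.generateFrom D = MeasurableSpace.pi := generateFrom_squareCylinders
  have hCpi : IsPiSystem C := isPiSystem_squareCylinders (fun _ => MeasurableSpace.isPiSystem_measurableSet)
    (by simp)
  have hDpi : IsPiSystem D := isPiSystem_squareCylinders (fun _ => MeasurableSpace.isPiSystem_measurableSet)
    (by simp)
  have huniv : ∀ {ι : Type} {α : ι → Type} [∀ i, MeasurableSpace (α i)],
      Set.univ ∈ squareCylinders fun i => {s : Set (α i) | MeasurableSet s} := by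
    intro ι α _
    exact ⟨∅, fun _ => Set.univ, by simp, by simp⟩
  have hCs : IsCountablySpanning C := ⟨fun _ => Set.univ, fun _ => huniv, Set.iUnion_const _⟩
  have hDs : IsCountablySpanning D := ⟨fun _ => Set.univ, fun _ => huniv, Set.iUnion_const _⟩
  refine ext_of_generate_finite _ (generateFrom_eq_prod hC hD hCs hDs).symm (hCpi.prod hDpi) ?_
    (by simp)
  rintro _ ⟨S, ⟨s, B, hB, rfl⟩, T, ⟨u, E, hE, rfl⟩, rfl⟩
  simp only [Set.mem_pi, Set.mem_univ, Set.mem_ofPred_eq, true_implies] at hB hE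
  obtain ⟨N, M, K, hloc⟩ := isLocal_indicator_cylinder s (fun p _ => hB p) u E
  have h1 := h N M K _ hloc
  have hm : MeasurableSet (((s : Set (ℤ × (Fin d → ℤ))).pi B) ×ˢ ((u : Set ℕ).pi E)) :=
    (MeasurableSet.pi s.countable_toSet fun p _ => hB p).prod
      (MeasurableSet.pi u.countable_toSet fun i _ => hE i)
  rw [integral_indicator_const _ hm, integral_indicator_const _ hm] at h1
  simpa [Measure.real, ENNReal.toReal_eq_toReal_iff'] using h1

/-! ### The tilt that produces a given velocity -/

theorem single_mem_stepSet (i : Fin d) {c : ℤ} (hc : |c| = 1) :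
    (Pi.single i c : Fin d → ℤ) ∈ stepSet d := by
  rw [mem_stepSet, Finset.sum_eq_single i (fun j _ hj => by simp [hj]) (by simp)]
  simpa using hc

theorem inner_toEuclid_single (θ : EuclideanSpace ℝ (Fin d)) (i : Fin d) (c : ℤ) :
    inner ℝ θ (toEuclid (Pi.single i c)) = (c : ℝ) * θ i := by
  have h : toEuclid (Pi.single i c : Fin d → ℤ) = EuclideanSpace.single i (c : ℝ) := by
    ext j
    by_cases hj : j = i
    · subst hj; simp [toEuclid]
    · simp [toEuclid, hj]
  rw [h, EuclideanSpace.inner_single_right]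
  simp

theorem exists_step_inner_eq_abs (θ : EuclideanSpace ℝ (Fin d)) (i : Fin d) :
    ∃ z : Step d, inner ℝ θ (toEuclid z.1) = |θ i| := by
  rcases le_total 0 (θ i) with h | h
  · exact ⟨⟨_, single_mem_stepSet i (c := 1) (by norm_num)⟩, by
      rw [inner_toEuclid_single, abs_of_nonneg h]; simp⟩
  · exact ⟨⟨_, single_mem_stepSet i (c := -1) (by norm_num)⟩, by
      rw [inner_toEuclid_single, abs_of_nonpos h]; simp⟩

/-- Dimension zero is excluded: with no steps, the mean step probabilities could not sum to one. -/
theorem exists_step (ρ : Measure (LocalEnv d)) [IsProbabilityMeasure ρ] : Nonempty (Step d) := by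
  by_contra h
  rw [not_nonempty_iff] at h
  have := sum_meanStep ρ
  simp at this

theorem exists_index (ρ : Measure (LocalEnv d)) [IsProbabilityMeasure ρ] : Nonempty (Fin d) := by
  obtain ⟨z, hz⟩ := exists_step ρ
  by_contra h
  rw [not_nonempty_iff] at h
  rw [mem_stepSet] at hz
  simp at hz

theorem le_meanStep (ρ : Measure (LocalEnv d)) [IsProbabilityMeasure ρ] {c : ℝ} {z : Step d}
    (h : ∀ᵐ s ∂ρ, c ≤ s.1 z) : c ≤ meanStep ρ z := by
  rw [meanStep_eq]
  have := integral_mono_ae (integrable_const c) (integrable_coord ρ z) h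
  simpa using this

/-- An interior point can be pushed radially outward to `(1 + t) ξ` with `t > 0` and still lie in
`𝒟`. -/
theorem sum_abs_lt_one_of_mem_interior {ξ : EuclideanSpace ℝ (Fin d)}
    (hξ : ξ ∈ interior (velocitySet d)) : ∑ i, |ξ i| < 1 := by
  have hcont : Tendsto (fun t : ℝ => (1 + t) • ξ) (𝓝[>] 0) (𝓝 ξ) := by
    have h : Continuous fun t : ℝ => (1 + t) • ξ := by fun_prop
    have := h.tendsto 0
    simp only [add_zero, one_smul] at this
    exact this.mono_left nhdsWithin_le_nhds
  have hev := (hcont.eventually (mem_interior_iff_mem_nhds.1 hξ)).and self_mem_nhdsWithin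
  obtain ⟨t, ht, ht0⟩ := hev.exists
  have ht0 : 0 < t := ht0
  have h1 : ∑ i, |((1 + t) • ξ) i| ≤ 1 := ht
  simp only [PiLp.smul_apply, smul_eq_mul, abs_mul, abs_of_pos (by linarith : 0 < 1 + t)] at h1
  rw [← Finset.mul_sum] at h1
  by_contra hcon
  push Not at hcon
  nlinarith

/-- The mean displacement of the tilted walk. -/
noncomputable def tiltedDrift (ρ : Measure (LocalEnv d)) (θ : EuclideanSpace ℝ (Fin d)) :
    EuclideanSpace ℝ (Fin d) :=
  ∑ z, (meanStep ρ z * stepWeight ρ θ z) • toEuclid z.1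

theorem hasGradientAt_logMGF (ρ : Measure (LocalEnv d)) [IsProbabilityMeasure ρ]
    (θ : EuclideanSpace ℝ (Fin d)) : HasGradientAt (logMGF ρ) (tiltedDrift ρ θ) θ := by
  have h1 : ∀ z : Step d, HasFDerivAt
      (fun θ : EuclideanSpace ℝ (Fin d) => meanStep ρ z * Real.exp (inner ℝ θ (toEuclid z.1)))
      (meanStep ρ z • Real.exp (inner ℝ θ (toEuclid z.1)) • innerSL ℝ (toEuclid z.1)) θ := by
    intro z
    have h2 : HasFDerivAt (fun θ : EuclideanSpace ℝ (Fin d) => inner ℝ θ (toEuclid z.1))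
        (innerSL ℝ (toEuclid z.1)) θ := by
      have h3 := (innerSL ℝ (toEuclid z.1)).hasFDerivAt (x := θ)
      refine h3.congr_of_eventuallyEq (Eventually.of_forall fun x => ?_)
      rw [innerSL_apply_apply, real_inner_comm]
    exact h2.exp.const_mul _
  have h4 := (HasFDerivAt.fun_sum fun z (_ : z ∈ Finset.univ) => h1 z).log
    (sum_meanStep_exp_pos ρ θ).ne'
  rw [hasGradientAt_iff_hasFDerivAt]
  refine h4.congr_fderiv ?_
  ext x
  simp only [InnerProductSpace.toDual_apply_apply, tiltedDrift, sum_inner, real_inner_smul_left,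
    stepWeight_eq, FunLike.coe_smul, Pi.smul_apply, smul_eq_mul, sum_apply,
    innerSL_apply_apply, Finset.mul_sum]
  refine Finset.sum_congr rfl fun z _ => ?_
  field_simp

theorem hasGradientAt_logMGF_iff (ρ : Measure (LocalEnv d)) [IsProbabilityMeasure ρ]
    (θ ξ : EuclideanSpace ℝ (Fin d)) : HasGradientAt (logMGF ρ) ξ θ ↔ tiltedDrift ρ θ = ξ :=
  ⟨fun h => (hasGradientAt_logMGF ρ θ).unique h, fun h => h ▸ hasGradientAt_logMGF ρ θ⟩

theorem logMGF_lower_bound (ρ : Measure (LocalEnv d)) [IsProbabilityMeasure ρ] {c : ℝ}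
    (hc : 0 < c) (hq : ∀ z : Step d, c ≤ meanStep ρ z) (θ : EuclideanSpace ℝ (Fin d))
    (z : Step d) : Real.log c + inner ℝ θ (toEuclid z.1) ≤ logMGF ρ θ := by
  have h1 : c * Real.exp (inner ℝ θ (toEuclid z.1)) ≤
      ∑ z : Step d, meanStep ρ z * Real.exp (inner ℝ θ (toEuclid z.1)) :=
    (mul_le_mul_of_nonneg_right (hq z) (Real.exp_pos _).le).trans
      (Finset.single_le_sum (f := fun z : Step d =>
        meanStep ρ z * Real.exp (inner ℝ θ (toEuclid z.1)))
        (fun z _ => mul_nonneg (meanStep_nonneg ρ z) (Real.exp_pos _).le) (Finset.mem_univ z))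
  have h2 := Real.log_le_log (mul_pos hc (Real.exp_pos _)) h1
  rwa [Real.log_mul hc.ne' (Real.exp_pos _).ne', Real.log_exp] at h2

theorem norm_le_sum_abs (θ : EuclideanSpace ℝ (Fin d)) : ‖θ‖ ≤ ∑ i, |θ i| := by
  rw [EuclideanSpace.norm_eq]
  refine Real.sqrt_le_iff.2 ⟨Finset.sum_nonneg fun i _ => abs_nonneg _, ?_⟩
  simp only [Real.norm_eq_abs]
  exact Finset.sum_sq_le_sq_sum_of_nonneg fun i _ => abs_nonneg _

/-- The function `Λ_c(θ) - ⟨ξ, θ⟩` is coercive, so it has a minimiser, where its gradient vanishes.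
-/
theorem exists_tiltedDrift_eq (ρ : Measure (LocalEnv d)) [IsProbabilityMeasure ρ] {c : ℝ}
    (hc : 0 < c) (hq : ∀ z : Step d, c ≤ meanStep ρ z) {ξ : EuclideanSpace ℝ (Fin d)}
    (hξ : ∑ i, |ξ i| < 1) : ∃ θ, tiltedDrift ρ θ = ξ := by
  have hd := exists_index ρ
  have hdpos : (0 : ℝ) < d := by
    have : 0 < d := Fin.pos_iff_nonempty.2 hd
    exact_mod_cast this
  have hgrad : ∀ θ, HasFDerivAt (fun θ => logMGF ρ θ - inner ℝ ξ θ)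
      (InnerProductSpace.toDual ℝ _ (tiltedDrift ρ θ) - innerSL ℝ ξ) θ := fun θ =>
    (hasGradientAt_logMGF ρ θ).hasFDerivAt.sub (innerSL ℝ ξ).hasFDerivAt
  -- With `|θ i|` maximal, a step `±e_i` gives `Λ_c(θ) ≥ log c + |θ i|`, while `⟨ξ, θ⟩ ≤ ‖ξ‖₁ |θ i|`
  -- and `‖θ‖ ≤ d |θ i|`.
  have hlow : ∀ θ : EuclideanSpace ℝ (Fin d),
      Real.log c + (1 - ∑ i, |ξ i|) / d * ‖θ‖ ≤ logMGF ρ θ - inner ℝ ξ θ := by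
    intro θ
    obtain ⟨i, hi⟩ := Finite.exists_max fun i => |θ i|
    obtain ⟨z, hz⟩ := exists_step_inner_eq_abs θ i
    have h1 := logMGF_lower_bound ρ hc hq θ z
    rw [hz] at h1
    have h2 : inner ℝ ξ θ ≤ (∑ i, |ξ i|) * |θ i| := by
      rw [PiLp.inner_apply, Finset.sum_mul]
      refine Finset.sum_le_sum fun j _ => ?_
      calc inner ℝ (ξ j) (θ j) ≤ |ξ j| * |θ j| := by
            simpa using real_inner_le_norm (ξ j) (θ j)
        _ ≤ |ξ j| * |θ i| := mul_le_mul_of_nonneg_left (hi j) (abs_nonneg _)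
    have h3 : ‖θ‖ ≤ d * |θ i| := by
      refine (norm_le_sum_abs θ).trans ((Finset.sum_le_sum fun j _ => hi j).trans ?_)
      simp
    have h4 : (1 - ∑ i, |ξ i|) / d * ‖θ‖ ≤ (1 - ∑ i, |ξ i|) * |θ i| := by
      rw [div_mul_eq_mul_div, div_le_iff₀ hdpos, mul_assoc, mul_comm |θ i|]
      exact mul_le_mul_of_nonneg_left h3 (by linarith)
    linarith
  have hcont : Continuous fun θ => logMGF ρ θ - inner ℝ ξ θ :=
    continuous_iff_continuousAt.2 fun θ => (hgrad θ).continuousAt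
  have hlim : Tendsto (fun θ => logMGF ρ θ - inner ℝ ξ θ)
      (cocompact (EuclideanSpace ℝ (Fin d))) atTop := by
    refine tendsto_atTop_mono hlow (tendsto_atTop_add_const_left _ _ ?_)
    exact (tendsto_norm_cocompact_atTop).const_mul_atTop (div_pos (by linarith) hdpos)
  obtain ⟨θ, hθ⟩ := hcont.exists_forall_le hlim
  refine ⟨θ, ?_⟩
  have h5 := IsLocalMin.hasFDerivAt_eq_zero (Eventually.of_forall hθ) (hgrad θ)
  refine ext_inner_right ℝ fun x => ?_
  have h6 := DFunLike.congr_fun h5 x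
  simpa [sub_eq_zero] using h6

/-- With `y` the log-ratio of the two tilted step laws, their symmetrised relative entropy is the
mean of `(e^y - 1) y`. It equals `⟨θ₂ - θ₁, ·⟩` applied to the difference of the drifts, hence
vanishes; its terms are nonnegative, so `y = 0`. -/
theorem tiltedDrift_injective (ρ : Measure (LocalEnv d)) [IsProbabilityMeasure ρ]
    (hq : ∀ z : Step d, 0 < meanStep ρ z) : Function.Injective (tiltedDrift ρ) := by
  intro θ₁ θ₂ h
  let y (z : Step d) : ℝ :=
    inner ℝ (θ₂ - θ₁) (toEuclid z.1) - (logMGF ρ θ₂ - logMGF ρ θ₁)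
  have hw : ∀ z, stepWeight ρ θ₂ z = stepWeight ρ θ₁ z * Real.exp (y z) := by
    intro z
    simp only [stepWeight, y, ← Real.exp_add, inner_sub_left]
    congr 1
    ring
  have hsum : ∀ θ, ∑ z, meanStep ρ z * stepWeight ρ θ z * y z =
      inner ℝ (θ₂ - θ₁) (tiltedDrift ρ θ) - (logMGF ρ θ₂ - logMGF ρ θ₁) := by
    intro θ
    simp only [y, mul_sub, Finset.sum_sub_distrib, ← Finset.sum_mul, sum_meanStep_stepWeight,
      tiltedDrift, inner_sum, real_inner_smul_right, one_mul]
  have hzero : ∑ z, meanStep ρ z * stepWeight ρ θ₁ z * ((Real.exp (y z) - 1) * y z) = 0 := by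
    have h2 : ∀ z, meanStep ρ z * stepWeight ρ θ₁ z * ((Real.exp (y z) - 1) * y z) =
        meanStep ρ z * stepWeight ρ θ₂ z * y z - meanStep ρ z * stepWeight ρ θ₁ z * y z := by
      intro z
      rw [hw]
      ring
    simp_rw [h2]
    rw [Finset.sum_sub_distrib, hsum, hsum, h, sub_self]
  have hpos : ∀ z ∈ Finset.univ,
      0 ≤ meanStep ρ z * stepWeight ρ θ₁ z * ((Real.exp (y z) - 1) * y z) := by
    intro z _
    refine mul_nonneg (mul_pos (hq z) (stepWeight_pos ρ θ₁ z)).le ?_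
    rcases le_total 0 (y z) with hy | hy
    · exact mul_nonneg (by linarith [Real.one_le_exp hy]) hy
    · exact mul_nonneg_of_nonpos_of_nonpos (by linarith [Real.exp_le_one_iff.2 hy]) hy
  have hy : ∀ z, y z = 0 := by
    intro z
    have h3 := (Finset.sum_eq_zero_iff_of_nonneg hpos).1 hzero z (Finset.mem_univ z)
    rcases mul_eq_zero.1 h3 with h4 | h4
    · exact absurd h4 (mul_pos (hq z) (stepWeight_pos ρ θ₁ z)).ne'
    · rcases mul_eq_zero.1 h4 with h5 | h5
      · exact (Real.exp_eq_one_iff _).1 (by linarith)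
      · exact h5
  -- Comparing the opposite steps `±e_i` eliminates the difference of the `Λ_c` values.
  ext i
  have h1 := hy ⟨_, single_mem_stepSet i (c := 1) (by norm_num)⟩
  have h2 := hy ⟨_, single_mem_stepSet i (c := -1) (by norm_num)⟩
  simp only [y, inner_toEuclid_single, PiLp.sub_apply] at h1 h2
  push_cast at h1 h2
  linarith

theorem existsUnique_hasGradientAt_logMGF (ρ : Measure (LocalEnv d)) [IsProbabilityMeasure ρ]
    (hell : ∃ c : ℝ, 0 < c ∧ ∀ z : Step d, ∀ᵐ s ∂ρ, c ≤ s.1 z)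
    {ξ : EuclideanSpace ℝ (Fin d)} (hξ : ξ ∈ interior (velocitySet d)) :
    ∃! θ : EuclideanSpace ℝ (Fin d), HasGradientAt (logMGF ρ) ξ θ := by
  obtain ⟨c, hc, hell⟩ := hell
  have hq : ∀ z : Step d, c ≤ meanStep ρ z := fun z => le_meanStep ρ (hell z)
  obtain ⟨θ, hθ⟩ := exists_tiltedDrift_eq ρ hc hq (sum_abs_lt_one_of_mem_interior hξ)
  refine ⟨θ, (hasGradientAt_logMGF_iff ρ θ ξ).2 hθ, fun θ' hθ' => ?_⟩
  exact tiltedDrift_injective ρ (fun z => hc.trans_le (hq z))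
    (((hasGradientAt_logMGF_iff ρ θ' ξ).1 hθ').trans hθ.symm)

/-! ### Concentration for finite-range functions of an i.i.d. sequence -/

section Concentration

variable {α : Type*} [MeasurableSpace α] (κ : Measure α) [IsProbabilityMeasure κ] {W : ℕ}

/-- The `j`-th window of length `W` of a sequence. -/
def window (W : ℕ) (a : ℕ → α) (j : ℕ) : Fin W → α := fun i => a (j + i)

theorem measurable_window (j : ℕ) : Measurable fun a : ℕ → α => window W a j :=
  measurable_pi_lambda _ fun _ => measurable_pi_apply _

theorem map_window (j : ℕ) :
    (Measure.infinitePi fun _ : ℕ => κ).map (fun a => window W a j) = Measure.pi fun _ => κ := by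
  have hinj : Function.Injective fun i : Fin W => j + (i : ℕ) := by
    intro i i' h
    exact Fin.ext (by simpa using h)
  rw [← Measure.infinitePi_eq_pi]
  exact Measure.map_infinitePi_infinitePi_of_inj (P := fun _ : ℕ => κ) hinj

/-- Windows whose starting points differ by multiples of `W` occupy disjoint blocks. -/
theorem iIndepFun_window (r : ℕ) :
    iIndepFun (fun (k : ℕ) (a : ℕ → α) => window W a (r + k * W))
      (Measure.infinitePi fun _ : ℕ => κ) := by
  rw [iIndepFun_iff_map_fun_eq_infinitePi_map fun k => measurable_window _]
  have hinj : Function.Injective fun q : ℕ × Fin W => r + q.1 * W + q.2 := by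
    rintro ⟨k, i⟩ ⟨k', i'⟩ h
    have hW : 0 < W := i.pos
    have h1 : i.1 + W * k = i'.1 + W * k' := by
      simp only at h
      nlinarith
    have h2 := congrArg (· / W) h1
    simp only [Nat.add_mul_div_left _ _ hW, Nat.div_eq_of_lt i.2, Nat.div_eq_of_lt i'.2,
      zero_add] at h2
    subst h2
    exact Prod.ext rfl (Fin.ext (by simpa using h1))
  have h1 := Measure.map_infinitePi_infinitePi_of_inj (P := fun _ : ℕ => κ) hinj
  have h2 := Measure.infinitePi_map_curry (fun (_ : ℕ) (_ : Fin W) => κ)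
  rw [← h1, Measure.map_map (MeasurableEquiv.measurable _) (by fun_prop)] at h2
  simp_rw [map_window, ← Measure.infinitePi_eq_pi]
  exact h2

theorem measure_sum_window_ge_le {F : (Fin W → α) → ℝ} (hF : Measurable F) {C : ℝ}
    (hC : ∀ b, |F b| ≤ C) (r m : ℕ) {t : ℝ} (ht : 0 ≤ t) :
    (Measure.infinitePi fun _ : ℕ => κ).real
      {a | t ≤ ∑ k ∈ Finset.range m,
        (F (window W a (r + k * W)) - ∫ b, F b ∂(Measure.pi fun _ => κ))} ≤
      Real.exp (-t ^ 2 / (2 * m * C ^ 2)) := by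
  have hmean : ∀ j, ∫ a, F (window W a j) ∂(Measure.infinitePi fun _ : ℕ => κ) =
      ∫ b, F b ∂(Measure.pi fun _ => κ) := fun j => by
    rw [← map_window κ j, integral_map (measurable_window j).aemeasurable
      hF.aestronglyMeasurable]
  have hindep : iIndepFun (fun (k : ℕ) (a : ℕ → α) =>
      F (window W a (r + k * W)) - ∫ b, F b ∂(Measure.pi fun _ => κ))
      (Measure.infinitePi fun _ : ℕ => κ) :=
    (iIndepFun_window κ r).comp (fun _ b => F b - ∫ b, F b ∂(Measure.pi fun _ => κ))
      fun _ => hF.sub_const _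
  have hsub : ∀ k < m, HasSubgaussianMGF (fun a : ℕ → α =>
      F (window W a (r + k * W)) - ∫ b, F b ∂(Measure.pi fun _ => κ)) ((‖C - -C‖₊ / 2) ^ 2)
      (Measure.infinitePi fun _ : ℕ => κ) := fun k _ => by
    rw [← hmean (r + k * W)]
    exact hasSubgaussianMGF_of_mem_Icc (hF.comp (measurable_window _)).aemeasurable
      (ae_of_all _ fun a => abs_le.1 (hC _))
  refine (HasSubgaussianMGF.measure_sum_range_ge_le_of_iIndepFun hindep hsub ht).trans_eq ?_
  congr 2
  push_cast
  rw [Real.norm_eq_abs, div_pow, sq_abs]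
  ring

theorem sum_range_mul_eq {M : Type*} [AddCommMonoid M] (g : ℕ → M) (W m : ℕ) :
    ∑ j ∈ Finset.range (m * W), g j =
      ∑ r ∈ Finset.range W, ∑ k ∈ Finset.range m, g (r + k * W) := by
  induction m with
  | zero => simp
  | succ m ih =>
    simp_rw [Finset.sum_range_succ _ m]
    rw [Finset.sum_add_distrib, ← ih, Nat.succ_mul, Finset.sum_range_add]
    simp_rw [add_comm (m * W)]

/-- Overlapping windows are dependent, but those in one residue class modulo `W` are not. A large
total forces one of the `W` classes to deviate by `t / W`; Hoeffding and a union bound over classes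
and signs give the factor `2W`. -/
theorem measure_abs_sum_window_gt_le {F : (Fin W → α) → ℝ} (hF : Measurable F) {C : ℝ}
    (hC : ∀ b, |F b| ≤ C) (m : ℕ) {t : ℝ} (ht : 0 ≤ t) :
    (Measure.infinitePi fun _ : ℕ => κ).real
      {a | t < |∑ j ∈ Finset.range (m * W),
        (F (window W a j) - ∫ b, F b ∂(Measure.pi fun _ => κ))|} ≤
      2 * W * Real.exp (-(t / W) ^ 2 / (2 * m * C ^ 2)) := by
  let g (a : ℕ → α) (j : ℕ) : ℝ := F (window W a j) - ∫ b, F b ∂(Measure.pi fun _ => κ)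
  let A (r : ℕ) : Set (ℕ → α) := {a | t / W ≤ ∑ k ∈ Finset.range m, g a (r + k * W)}
  let B (r : ℕ) : Set (ℕ → α) := {a | t / W ≤ ∑ k ∈ Finset.range m, -g a (r + k * W)}
  have ht' : 0 ≤ t / W := div_nonneg ht (Nat.cast_nonneg _)
  have hA : ∀ r, (Measure.infinitePi fun _ : ℕ => κ).real (A r) ≤
      Real.exp (-(t / W) ^ 2 / (2 * m * C ^ 2)) := fun r =>
    measure_sum_window_ge_le κ hF hC r m ht'
  have hB : ∀ r, (Measure.infinitePi fun _ : ℕ => κ).real (B r) ≤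
      Real.exp (-(t / W) ^ 2 / (2 * m * C ^ 2)) := fun r => by
    have h := measure_sum_window_ge_le κ (F := fun b => -F b) hF.neg
      (fun b => by rw [abs_neg]; exact hC b) r m ht'
    refine le_trans (le_of_eq ?_) h
    congr 1
    ext a
    simp only [B, g, integral_neg, Set.mem_ofPred_eq]
    rw [iff_iff_eq]
    congr 1
    exact Finset.sum_congr rfl fun k _ => by ring
  have hsub : {a | t < |∑ j ∈ Finset.range (m * W), g a j|} ⊆
      ⋃ r ∈ Finset.range W, (A r ∪ B r) := by
    intro a ha
    by_contra hcon
    simp only [Set.mem_iUnion, Set.mem_union, not_exists, not_or, A, B, Set.mem_ofPred_eq,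
      not_le, Finset.sum_neg_distrib] at hcon
    have h1 : |∑ j ∈ Finset.range (m * W), g a j| ≤ ∑ r ∈ Finset.range W, t / W := by
      rw [sum_range_mul_eq]
      refine (Finset.abs_sum_le_sum_abs _ _).trans (Finset.sum_le_sum fun r hr => ?_)
      have := hcon r hr
      exact abs_le.2 ⟨by linarith [this.2], this.1.le⟩
    have h2 : ∑ r ∈ Finset.range W, t / W ≤ t := by
      rw [Finset.sum_const, Finset.card_range, nsmul_eq_mul]
      rcases eq_or_ne (W : ℝ) 0 with h | h
      · simpa [h] using ht
      · rw [mul_div_cancel₀ _ h]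
    exact absurd ha (not_lt.2 (h1.trans h2))
  refine (measureReal_mono hsub (measure_ne_top _ _)).trans ((measureReal_biUnion_finset_le _ _).trans ?_)
  calc ∑ r ∈ Finset.range W, (Measure.infinitePi fun _ : ℕ => κ).real (A r ∪ B r)
      ≤ ∑ r ∈ Finset.range W, (2 * Real.exp (-(t / W) ^ 2 / (2 * m * C ^ 2))) :=
        Finset.sum_le_sum fun r _ => (measureReal_union_le _ _).trans
          (by linarith [hA r, hB r])
    _ = 2 * W * Real.exp (-(t / W) ^ 2 / (2 * m * C ^ 2)) := by
        rw [Finset.sum_const, Finset.card_range, nsmul_eq_mul]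
        ring

end Concentration

/-! ### The law of large numbers for the tilted walk -/

theorem measurable_toEuclid_step : Measurable fun a : Site d => toEuclid a.2.1 :=
  (measurable_of_countable fun z : Step d => toEuclid z.1).comp measurable_snd

theorem measurable_toEuclid_step_apply {ι : Type*} (i : ι) :
    Measurable fun a : ι → Site d => toEuclid (a i).2.1 :=
  measurable_toEuclid_step.comp (g := fun a : Site d => toEuclid a.2.1)
    (measurable_pi_apply (X := fun _ : ι => Site d) i)

theorem strongLaw_tilted (ρ : Measure (LocalEnv d)) [IsProbabilityMeasure ρ]
    (θ : EuclideanSpace ℝ (Fin d)) :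
    ∀ᵐ a ∂(Measure.infinitePi fun _ : ℕ => siteMeasure ρ θ),
      Tendsto (fun n : ℕ => (n : ℝ)⁻¹ • ∑ i ∈ Finset.range n, toEuclid (a i).2.1) atTop
        (𝓝 (tiltedDrift ρ θ)) := by
  have hmap : ∀ i : ℕ, (Measure.infinitePi fun _ : ℕ => siteMeasure ρ θ).map
      (fun a => a i) = siteMeasure ρ θ := fun i => Measure.infinitePi_map_eval _ i
  have hid : ∀ i : ℕ, IdentDistrib (fun a : ℕ → Site d => a i) (fun a => a 0)
      (Measure.infinitePi fun _ : ℕ => siteMeasure ρ θ)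
      (Measure.infinitePi fun _ : ℕ => siteMeasure ρ θ) := fun i =>
    ⟨(measurable_pi_apply i).aemeasurable, (measurable_pi_apply 0).aemeasurable, by
      rw [hmap, hmap]⟩
  have hindep := iIndepFun_infinitePi (P := fun _ : ℕ => siteMeasure ρ θ)
    (X := fun _ a => toEuclid a.2.1) fun _ => measurable_toEuclid_step
  have hbdd : ∃ C : ℝ, ∀ z : Step d, ‖toEuclid z.1‖ ≤ C := by
    obtain ⟨C, hC⟩ := (Set.finite_range fun z : Step d => ‖toEuclid z.1‖).bddAbove
    exact ⟨C, fun z => hC ⟨z, rfl⟩⟩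
  obtain ⟨C, hC⟩ := hbdd
  have hslln := strong_law_ae (μ := Measure.infinitePi fun _ : ℕ => siteMeasure ρ θ)
    (fun (i : ℕ) (a : ℕ → Site d) => toEuclid (a i).2.1)
    (Integrable.of_bound (measurable_toEuclid_step_apply 0).aestronglyMeasurable C
      (ae_of_all _ fun a => hC _))
    (fun i j hij => hindep.indepFun hij)
    (fun i => (hid i).comp measurable_toEuclid_step)
  have hmean : ∫ a, toEuclid (a 0).2.1 ∂(Measure.infinitePi fun _ : ℕ => siteMeasure ρ θ) =
      tiltedDrift ρ θ := by
    rw [tiltedDrift, ← integral_siteMeasure_snd ρ θ fun z => toEuclid z.1]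
    conv_rhs => rw [← hmap 0]
    exact (integral_map (φ := fun a : ℕ → Site d => a 0) (measurable_pi_apply 0).aemeasurable
      measurable_toEuclid_step.aestronglyMeasurable).symm
  rwa [hmean] at hslln

/-- The event that a finite sequence of sites has mean velocity `δ`-close to `ξ`. -/
def siteVelocityEvent (ξ : EuclideanSpace ℝ (Fin d)) (δ : ℝ) (n : ℕ) : Set (Fin n → Site d) :=
  {b | ‖(n : ℝ)⁻¹ • (∑ i, toEuclid (b i).2.1) - ξ‖ ≤ δ}

theorem measurableSet_siteVelocityEvent (ξ : EuclideanSpace ℝ (Fin d)) (δ : ℝ) (n : ℕ) :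
    MeasurableSet (siteVelocityEvent ξ δ n) := by
  have h : Measurable fun b : Fin n → Site d => ∑ i, toEuclid (b i).2.1 :=
    Finset.measurable_sum _ fun i _ => measurable_toEuclid_step_apply i
  have h' : Measurable fun b : Fin n → Site d =>
      (n : ℝ)⁻¹ • (∑ i, toEuclid (b i).2.1) - ξ := (h.const_smul (n : ℝ)⁻¹).sub_const ξ
  exact measurableSet_le h'.norm measurable_const

/-- The strong law implies convergence in probability; no rate is needed, only a lower bound on the
conditioning event. -/
theorem eventually_half_le_siteVelocityEvent (ρ : Measure (LocalEnv d)) [IsProbabilityMeasure ρ]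
    {θ ξ : EuclideanSpace ℝ (Fin d)} (hθ : tiltedDrift ρ θ = ξ) {δ : ℝ} (hδ : 0 < δ) :
    ∀ᶠ n : ℕ in atTop,
      1 / 2 ≤ (Measure.pi fun _ : Fin n => siteMeasure ρ θ).real (siteVelocityEvent ξ δ n) := by
  have hmeas : ∀ n : ℕ, Measurable fun a : ℕ → Site d =>
      (n : ℝ)⁻¹ • ∑ i ∈ Finset.range n, toEuclid (a i).2.1 := fun n => by
    have h : Measurable fun a : ℕ → Site d => ∑ i ∈ Finset.range n, toEuclid (a i).2.1 :=
      Finset.measurable_sum _ fun i _ => measurable_toEuclid_step_apply i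
    exact h.const_smul (n : ℝ)⁻¹
  have h1 := tendstoInMeasure_of_tendsto_ae (fun n => (hmeas n).aestronglyMeasurable)
    (strongLaw_tilted ρ θ)
  have h2 := tendstoInMeasure_iff_measureReal_norm.1 h1 δ hδ
  filter_upwards [h2.eventually (ge_mem_nhds (by norm_num : (0 : ℝ) < 1 / 2))] with n hn
  have h3 : (Measure.pi fun _ : Fin n => siteMeasure ρ θ).real (siteVelocityEvent ξ δ n)ᶜ ≤
      1 / 2 := by
    rw [← map_window (siteMeasure ρ θ) 0, map_measureReal_apply (measurable_window 0)
      (measurableSet_siteVelocityEvent ξ δ n).compl]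
    refine (measureReal_mono fun a ha => ?_).trans hn
    simp only [siteVelocityEvent, window, zero_add, Set.preimage_compl, Set.mem_compl_iff,
      Set.mem_preimage, Set.mem_ofPred_eq, not_le] at ha
    rw [Set.mem_ofPred_eq, hθ, Finset.sum_range]
    exact ha.le
  rw [probReal_compl_eq_one_sub (measurableSet_siteVelocityEvent ξ δ n)] at h3
  linarith

/-! ### Comparison of the averaged walk with the tilted walk -/

theorem velocityEvent_eq (ξ : EuclideanSpace ℝ (Fin d)) (δ : ℝ) (n : ℕ) :
    velocityEvent ξ δ n =
      (fun (p : EnvSteps d) (i : Fin n) => sites p i) ⁻¹' siteVelocityEvent ξ δ n := by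
  ext p
  simp only [velocityEvent, siteVelocityEvent, sites, pos, toEuclid_sum, Finset.sum_range,
    Set.mem_preimage, Set.mem_ofPred_eq]

theorem measurable_sites_fin (n : ℕ) :
    Measurable fun (p : EnvSteps d) (i : Fin n) => sites p i :=
  measurable_pi_lambda _ fun i => measurable_sites i

theorem measurableSet_velocityEvent (ξ : EuclideanSpace ℝ (Fin d)) (δ : ℝ) (n : ℕ) :
    MeasurableSet (velocityEvent ξ δ n) := by
  rw [velocityEvent_eq]
  exact measurable_sites_fin n (measurableSet_siteVelocityEvent ξ δ n)

theorem pi_siteMeasure_apply (ρ : Measure (LocalEnv d)) [IsProbabilityMeasure ρ]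
    (θ : EuclideanSpace ℝ (Fin d)) (n : ℕ) {S : Set (Fin (n + 1) → Site d)}
    (hS : MeasurableSet S) :
    Measure.pi (fun _ => siteMeasure ρ θ) S =
      ∫⁻ p in (fun (p : EnvSteps d) (i : Fin (n + 1)) => sites p i) ⁻¹' S,
        ENNReal.ofReal (tiltDensity ρ θ (n + 1) p) ∂(averagedMeasure ρ) := by
  rw [← map_sites_tilted, Measure.map_apply (measurable_sites_fin _) hS,
    withDensity_apply _ (measurable_sites_fin _ hS)]

/-- By Cauchy–Schwarz the tilt is nearly constant on the velocity event, with an error in the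
exponent of at most `n‖θ‖δ`. -/
theorem abs_inner_sub_le (θ : EuclideanSpace ℝ (Fin d)) {ξ : EuclideanSpace ℝ (Fin d)} {δ : ℝ}
    {n : ℕ} (hn : 0 < n) {p : EnvSteps d} (hp : p ∈ velocityEvent ξ δ n) :
    |inner ℝ θ (toEuclid (pos p.2 n)) - n * inner ℝ θ ξ| ≤ n * (‖θ‖ * δ) := by
  have hn' : (0 : ℝ) < n := by exact_mod_cast hn
  have h1 : inner ℝ θ (toEuclid (pos p.2 n)) - n * inner ℝ θ ξ =
      n * inner ℝ θ ((n : ℝ)⁻¹ • toEuclid (pos p.2 n) - ξ) := by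
    rw [inner_sub_right, real_inner_smul_right]
    field_simp
  rw [h1, abs_mul, abs_of_pos hn']
  refine mul_le_mul_of_nonneg_left ?_ hn'.le
  exact (abs_real_inner_le_norm _ _).trans (mul_le_mul_of_nonneg_left hp (norm_nonneg _))

theorem tiltDensity_le (ρ : Measure (LocalEnv d)) (θ : EuclideanSpace ℝ (Fin d))
    {ξ : EuclideanSpace ℝ (Fin d)} {δ : ℝ} {n : ℕ} (hn : 0 < n) {p : EnvSteps d}
    (hp : p ∈ velocityEvent ξ δ n) :
    tiltDensity ρ θ n p ≤ Real.exp (n * (inner ℝ θ ξ - logMGF ρ θ) + n * (‖θ‖ * δ)) := by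
  refine Real.exp_le_exp.2 ?_
  have := (abs_le.1 (abs_inner_sub_le θ hn hp)).2
  linarith

theorem le_tiltDensity (ρ : Measure (LocalEnv d)) (θ : EuclideanSpace ℝ (Fin d))
    {ξ : EuclideanSpace ℝ (Fin d)} {δ : ℝ} {n : ℕ} (hn : 0 < n) {p : EnvSteps d}
    (hp : p ∈ velocityEvent ξ δ n) :
    Real.exp (n * (inner ℝ θ ξ - logMGF ρ θ) - n * (‖θ‖ * δ)) ≤ tiltDensity ρ θ n p := by
  refine Real.exp_le_exp.2 ?_
  have := (abs_le.1 (abs_inner_sub_le θ hn hp)).1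
  linarith

theorem pi_siteVelocityEvent_le (ρ : Measure (LocalEnv d)) [IsProbabilityMeasure ρ]
    (θ ξ : EuclideanSpace ℝ (Fin d)) (δ : ℝ) {n : ℕ} (hn : 0 < n) :
    (Measure.pi fun _ : Fin n => siteMeasure ρ θ).real (siteVelocityEvent ξ δ n) ≤
      Real.exp (n * (inner ℝ θ ξ - logMGF ρ θ) + n * (‖θ‖ * δ)) *
        (averagedMeasure ρ).real (velocityEvent ξ δ n) := by
  obtain ⟨n, rfl⟩ := Nat.exists_eq_succ_of_ne_zero hn.ne'
  have h : Measure.pi (fun _ : Fin (n + 1) => siteMeasure ρ θ) (siteVelocityEvent ξ δ (n + 1)) ≤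
      ENNReal.ofReal (Real.exp ((n + 1 : ℕ) * (inner ℝ θ ξ - logMGF ρ θ) +
        (n + 1 : ℕ) * (‖θ‖ * δ))) * averagedMeasure ρ (velocityEvent ξ δ (n + 1)) := by
    rw [pi_siteMeasure_apply ρ θ n (measurableSet_siteVelocityEvent ξ δ (n + 1)),
      ← velocityEvent_eq, ← setLIntegral_const]
    exact setLIntegral_mono measurable_const fun p hp =>
      ENNReal.ofReal_le_ofReal (tiltDensity_le ρ θ hn hp)
  have h2 := ENNReal.toReal_mono
    (ENNReal.mul_ne_top ENNReal.ofReal_ne_top (measure_ne_top _ _)) h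
  rwa [ENNReal.toReal_mul, ENNReal.toReal_ofReal (Real.exp_pos _).le] at h2

theorem averagedMeasure_velocityEvent_inter_le (ρ : Measure (LocalEnv d))
    [IsProbabilityMeasure ρ] (θ ξ : EuclideanSpace ℝ (Fin d)) (δ : ℝ) {n : ℕ} (hn : 0 < n)
    {S : Set (Fin n → Site d)} (hS : MeasurableSet S) :
    Real.exp (n * (inner ℝ θ ξ - logMGF ρ θ) - n * (‖θ‖ * δ)) *
      (averagedMeasure ρ).real (velocityEvent ξ δ n ∩
        (fun (p : EnvSteps d) (i : Fin n) => sites p i) ⁻¹' S) ≤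
      (Measure.pi fun _ : Fin n => siteMeasure ρ θ).real S := by
  obtain ⟨n, rfl⟩ := Nat.exists_eq_succ_of_ne_zero hn.ne'
  have h : ENNReal.ofReal (Real.exp ((n + 1 : ℕ) * (inner ℝ θ ξ - logMGF ρ θ) -
      (n + 1 : ℕ) * (‖θ‖ * δ))) * averagedMeasure ρ (velocityEvent ξ δ (n + 1) ∩
        (fun (p : EnvSteps d) (i : Fin (n + 1)) => sites p i) ⁻¹' S) ≤
      Measure.pi (fun _ : Fin (n + 1) => siteMeasure ρ θ) S := by
    rw [pi_siteMeasure_apply ρ θ n hS, ← setLIntegral_const]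
    refine (setLIntegral_mono (ENNReal.measurable_ofReal.comp (measurable_tiltDensity ρ θ (n + 1)))
      fun p hp => ENNReal.ofReal_le_ofReal (le_tiltDensity ρ θ hn hp.1)).trans ?_
    exact lintegral_mono_set Set.inter_subset_right
  have h2 := ENNReal.toReal_mono (measure_ne_top _ _) h
  rwa [ENNReal.toReal_mul, ENNReal.toReal_ofReal (Real.exp_pos _).le] at h2

theorem eventually_averagedMeasure_velocityEvent_pos (ρ : Measure (LocalEnv d))
    [IsProbabilityMeasure ρ] {θ ξ : EuclideanSpace ℝ (Fin d)} (hθ : tiltedDrift ρ θ = ξ) {δ : ℝ}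
    (hδ : 0 < δ) : ∀ᶠ n : ℕ in atTop, 0 < (averagedMeasure ρ).real (velocityEvent ξ δ n) := by
  filter_upwards [eventually_half_le_siteVelocityEvent ρ hθ hδ, eventually_gt_atTop 0]
    with n h1 hn
  have h2 := pi_siteVelocityEvent_le ρ θ ξ δ hn
  exact pos_of_mul_pos_right (by linarith) (Real.exp_pos _).le

/-- In the quotient the common factor `e^{n(⟨θ, ξ⟩ - Λ_c(θ))}` cancels. Numerator and denominator
each contribute an error `e^{n‖θ‖δ}`, and the factor `2` comes from the tilted probability `≥ 1/2`
of the velocity event. -/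
theorem eventually_cond_le (ρ : Measure (LocalEnv d))
    [IsProbabilityMeasure ρ] {θ ξ : EuclideanSpace ℝ (Fin d)} (hθ : tiltedDrift ρ θ = ξ) {δ : ℝ}
    (hδ : 0 < δ) : ∀ᶠ n : ℕ in atTop, ∀ (S : Set (Fin n → Site d)) (T : Set (EnvSteps d)),
      MeasurableSet S → T ⊆ (fun (p : EnvSteps d) (i : Fin n) => sites p i) ⁻¹' S →
      (ProbabilityTheory.cond (averagedMeasure ρ) (velocityEvent ξ δ n)).real T ≤
        2 * Real.exp (2 * n * (‖θ‖ * δ)) *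
          (Measure.pi fun _ : Fin n => siteMeasure ρ θ).real S := by
  filter_upwards [eventually_half_le_siteVelocityEvent ρ hθ hδ,
    eventually_averagedMeasure_velocityEvent_pos ρ hθ hδ, eventually_gt_atTop 0]
    with n h1 hpos hn S T hS hT
  have h2 := pi_siteVelocityEvent_le ρ θ ξ δ hn
  have h3 := averagedMeasure_velocityEvent_inter_le ρ θ ξ δ hn hS
  rw [Real.exp_add] at h2
  rw [Real.exp_sub] at h3
  have h4 : Real.exp (2 * n * (‖θ‖ * δ)) =
      Real.exp (n * (‖θ‖ * δ)) * Real.exp (n * (‖θ‖ * δ)) := by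
    rw [← Real.exp_add]
    congr 1
    ring
  rw [Measure.real, cond_apply (measurableSet_velocityEvent ξ δ n), ENNReal.toReal_mul,
    ENNReal.toReal_inv, ← Measure.real, ← Measure.real, h4]
  set u := Real.exp (n * (inner ℝ θ ξ - logMGF ρ θ))
  set e := Real.exp (n * (‖θ‖ * δ))
  set v := (averagedMeasure ρ).real (velocityEvent ξ δ n)
  set s := (Measure.pi fun _ : Fin n => siteMeasure ρ θ).real S
  have hu : 0 < u := Real.exp_pos _
  have he : 0 < e := Real.exp_pos _
  have hs : 0 ≤ s := measureReal_nonneg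
  have h5 : (averagedMeasure ρ).real (velocityEvent ξ δ n ∩ T) ≤ s * e / u := by
    rw [le_div_iff₀ hu]
    have h6 : (averagedMeasure ρ).real (velocityEvent ξ δ n ∩ T) ≤
        (averagedMeasure ρ).real (velocityEvent ξ δ n ∩
          (fun (p : EnvSteps d) (i : Fin n) => sites p i) ⁻¹' S) :=
      measureReal_mono (Set.inter_subset_inter_right _ hT)
    rw [div_mul_eq_mul_div, div_le_iff₀ he] at h3
    nlinarith
  rw [inv_mul_le_iff₀ hpos]
  refine h5.trans ?_
  rw [div_le_iff₀ hu]
  nlinarith [mul_nonneg hs he.le]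

/-! ### Deviations of the empirical process -/

theorem integral_empirical {f : EnvSteps d → ℝ} (hf : Measurable f) (n : ℕ) (p : EnvSteps d) :
    ∫ y, f y ∂(empirical n p) = (n : ℝ)⁻¹ * ∑ j ∈ Finset.range n, f (seenAt j p) := by
  rw [empirical, integral_smul_measure, integral_finsetSum_measure fun j _ =>
    (integrable_dirac' hf.stronglyMeasurable (by simp))]
  simp_rw [integral_dirac' f _ hf.stronglyMeasurable]
  simp

/-- The event that the sum of a function over the windows deviates from its mean. -/
def windowDeviationEvent {W : ℕ} (F : (Fin W → Site d) → ℝ) (m₀ t : ℝ) (k n : ℕ) :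
    Set (Fin (n + 1) → Site d) :=
  {b | t < |∑ j ∈ Finset.range k, (F (window W (periodize b) j) - m₀)|}

theorem measurableSet_windowDeviationEvent {W : ℕ} {F : (Fin W → Site d) → ℝ}
    (hF : Measurable F) (m₀ t : ℝ) (k n : ℕ) :
    MeasurableSet (windowDeviationEvent F m₀ t k n) := by
  have h : Measurable fun b : Fin (n + 1) → Site d =>
      ∑ j ∈ Finset.range k, (F (window W (periodize b) j) - m₀) :=
    Finset.measurable_sum _ fun j _ =>
      (hF.comp ((measurable_window j).comp measurable_periodize)).sub_const m₀
  exact measurableSet_lt measurable_const (_root_.continuous_abs.measurable.comp h)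

theorem window_periodize {W j n : ℕ} (h : j + W ≤ n + 1) (a : ℕ → Site d) :
    window W (periodize fun i : Fin (n + 1) => a i) j = window W a j :=
  funext fun i => periodize_restrict a (by omega)

theorem pi_windowDeviationEvent_le (ρ : Measure (LocalEnv d)) [IsProbabilityMeasure ρ]
    (θ : EuclideanSpace ℝ (Fin d)) {W : ℕ} {F : (Fin W → Site d) → ℝ} (hF : Measurable F) {C : ℝ}
    (hC : ∀ b, |F b| ≤ C) {m n : ℕ} (hmn : m * W + W ≤ n + 1) {t : ℝ} (ht : 0 ≤ t) :
    (Measure.pi fun _ : Fin (n + 1) => siteMeasure ρ θ).real (windowDeviationEvent F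
      (∫ b, F b ∂(Measure.pi fun _ => siteMeasure ρ θ)) t (m * W) n) ≤
      2 * W * Real.exp (-(t / W) ^ 2 / (2 * m * C ^ 2)) := by
  refine le_trans (le_of_eq ?_) (measure_abs_sum_window_gt_le (siteMeasure ρ θ) hF hC m ht)
  rw [← map_window (siteMeasure ρ θ) 0, map_measureReal_apply (measurable_window 0)
    (measurableSet_windowDeviationEvent hF _ _ _ _)]
  congr 1
  ext a
  simp only [windowDeviationEvent, Set.mem_preimage, Set.mem_ofPred_eq]
  have h : ∀ j ∈ Finset.range (m * W), F (window W (periodize (window (n + 1) a 0)) j) -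
      ∫ b, F b ∂(Measure.pi fun _ => siteMeasure ρ θ) =
      F (window W a j) - ∫ b, F b ∂(Measure.pi fun _ => siteMeasure ρ θ) := by
    intro j hj
    rw [Finset.mem_range] at hj
    have h1 : window (n + 1) a 0 = fun i : Fin (n + 1) => a i := by
      funext i
      simp [window]
    rw [h1, window_periodize (by omega)]
  rw [Finset.sum_congr rfl h]

/-- The first `N` terms must be dropped, since there the walker looks at levels before time `0`,
which are not sites; the last ones look beyond the horizon. Each dropped term costs at most `2C`. -/
theorem abs_sum_sub_le {g : ℕ → ℝ} {C m₀ : ℝ} (hg : ∀ j, |g j| ≤ C) (hm : |m₀| ≤ C) {N k n : ℕ}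
    (h : N + k ≤ n) : |∑ j ∈ Finset.range n, (g j - m₀)| ≤
      |∑ j ∈ Finset.range k, (g (j + N) - m₀)| + (n - k : ℝ) * (2 * C) := by
  obtain ⟨l, rfl⟩ := Nat.exists_eq_add_of_le h
  have hb : ∀ j, |g j - m₀| ≤ 2 * C := fun j =>
    (abs_sub _ _).trans (by linarith [hg j])
  have h1 : |∑ j ∈ Finset.range N, (g j - m₀)| ≤ N * (2 * C) :=
    (Finset.abs_sum_le_sum_abs _ _).trans
      ((Finset.sum_le_sum fun j _ => hb j).trans (by simp))
  have h2 : |∑ j ∈ Finset.range l, (g (N + k + j) - m₀)| ≤ l * (2 * C) :=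
    (Finset.abs_sum_le_sum_abs _ _).trans
      ((Finset.sum_le_sum fun j _ => hb _).trans (by simp))
  rw [Finset.sum_range_add, Finset.sum_range_add]
  simp_rw [add_comm N]
  rw [add_comm k N]
  have h3 := abs_add_le (∑ j ∈ Finset.range N, (g j - m₀) +
    ∑ j ∈ Finset.range k, (g (j + N) - m₀)) (∑ j ∈ Finset.range l, (g (N + k + j) - m₀))
  have h4 := abs_add_le (∑ j ∈ Finset.range N, (g j - m₀))
    (∑ j ∈ Finset.range k, (g (j + N) - m₀))
  push_cast
  linarith

/-- With `W = N + M + K + 1`, at most `2W` terms are dropped, at a total cost of `4WC`. By `hε` this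
is at most half of the deviation `(n + 1)ε`; the other half remains for the windows. -/
theorem IsLocal.deviationEvent_subset {N M K : ℕ} {f : EnvSteps d → ℝ} (hf : IsLocal N M K f)
    {C : ℝ} (hC : ∀ p, |f p| ≤ C) (ρ : Measure (LocalEnv d)) [IsProbabilityMeasure ρ]
    (θ : EuclideanSpace ℝ (Fin d)) {ε : ℝ} {m n : ℕ}
    (hmn : m * (N + M + K + 1) + (N + M + K + 1) ≤ n + 1)
    (hnm : n + 1 ≤ m * (N + M + K + 1) + 2 * (N + M + K + 1))
    (hε : 8 * (N + M + K + 1 : ℕ) * C ≤ (n + 1 : ℕ) * ε) :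
    deviationEvent (tiltedMeasure ρ θ) f ε (n + 1) ⊆
      (fun (p : EnvSteps d) (i : Fin (n + 1)) => sites p i) ⁻¹'
        windowDeviationEvent (windowFun N M K f)
          (∫ b, windowFun N M K f b ∂(Measure.pi fun _ => siteMeasure ρ θ))
          ((n + 1 : ℕ) * ε / 2) (m * (N + M + K + 1)) n := by
  intro p hp
  have hn : (0 : ℝ) < (n + 1 : ℕ) := by positivity
  set m₀ := ∫ b, windowFun N M K f b ∂(Measure.pi fun _ => siteMeasure ρ θ)
  have hm₀ : |m₀| ≤ C := by
    have := norm_integral_le_of_norm_le_const (μ := Measure.pi fun _ => siteMeasure ρ θ)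
      (f := windowFun N M K f) (C := C) (ae_of_all _ fun b => hC (unview N (periodize b)))
    simpa using this
  have hp : ε < |∫ y, f y ∂(empirical (n + 1) p) - ∫ y, f y ∂(tiltedMeasure ρ θ)| := hp
  rw [integral_empirical hf.measurable_fun, hf.integral_tiltedMeasure] at hp
  have h1 : ((n + 1 : ℕ) : ℝ) * ε < |∑ j ∈ Finset.range (n + 1), (f (seenAt j p) - m₀)| := by
    have h2 : ((n + 1 : ℕ) : ℝ)⁻¹ * ∑ j ∈ Finset.range (n + 1), f (seenAt j p) - m₀ =
        ((n + 1 : ℕ) : ℝ)⁻¹ * ∑ j ∈ Finset.range (n + 1), (f (seenAt j p) - m₀) := by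
      rw [Finset.sum_sub_distrib, Finset.sum_const, Finset.card_range, nsmul_eq_mul]
      field_simp
    rw [h2, abs_mul, abs_of_pos (inv_pos.2 hn), lt_inv_mul_iff₀ hn] at hp
    exact hp
  have h3 := abs_sum_sub_le (g := fun j => f (seenAt j p)) (fun j => hC _) hm₀
    (N := N) (k := m * (N + M + K + 1)) (n := n + 1) (by omega)
  have hC0 : 0 ≤ C := (abs_nonneg _).trans (hC p)
  have h4 : (((n + 1 : ℕ) : ℝ) - (m * (N + M + K + 1) : ℕ)) * (2 * C) ≤
      (2 * (N + M + K + 1) : ℕ) * (2 * C) := by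
    refine mul_le_mul_of_nonneg_right ?_ (by linarith)
    rw [sub_le_iff_le_add]
    exact_mod_cast hnm.trans (by omega)
  have h5 : ∑ j ∈ Finset.range (m * (N + M + K + 1)), (f (seenAt (j + N) p) - m₀) =
      ∑ j ∈ Finset.range (m * (N + M + K + 1)), (windowFun N M K f (window (N + M + K + 1)
        (periodize fun i : Fin (n + 1) => sites p i) j) - m₀) := by
    refine Finset.sum_congr rfl fun j hj => ?_
    rw [Finset.mem_range] at hj
    rw [hf.seenAt_add, hf.unview_eq, window_periodize (by omega)]
    rfl
  simp only [windowDeviationEvent, Set.mem_preimage, Set.mem_ofPred_eq]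
  rw [← h5]
  push_cast at *
  linarith

theorem log_div_le_of_real_le_exp {x : ℝ≥0∞} (hx : x ≠ ∞) {n : ℕ} (hn : 0 < n) {c : ℝ}
    (h : x.toReal ≤ Real.exp (n * c)) : ENNReal.log x / (n : EReal) ≤ (c : EReal) := by
  have hn' : (0 : EReal) < (n : EReal) := by exact_mod_cast hn
  rw [EReal.div_le_iff_le_mul hn' (EReal.natCast_ne_top n)]
  have h1 : x ≤ ENNReal.ofReal (Real.exp (n * c)) := by
    rw [← ENNReal.ofReal_toReal hx]
    exact ENNReal.ofReal_le_ofReal h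
  refine (ENNReal.log_le_log h1).trans_eq ?_
  rw [ENNReal.log_ofReal_of_pos (Real.exp_pos _), Real.log_exp, EReal.coe_mul]
  rfl

/-- Exponential decay of the conditional probability of a deviation of the empirical process. -/
theorem IsLocal.eventually_cond_deviationEvent_le {N M K : ℕ} {f : EnvSteps d → ℝ}
    (hf : IsLocal N M K f) (ρ : Measure (LocalEnv d)) [IsProbabilityMeasure ρ]
    {θ ξ : EuclideanSpace ℝ (Fin d)} (hθ : tiltedDrift ρ θ = ξ) {ε : ℝ} (hε : 0 < ε) :
    ∃ c : ℝ, 0 < c ∧ ∀ δ : ℝ, 0 < δ → ‖θ‖ * δ ≤ c → ∀ᶠ n : ℕ in atTop,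
      (ProbabilityTheory.cond (averagedMeasure ρ) (velocityEvent ξ δ n)).real
        (deviationEvent (tiltedMeasure ρ θ) f ε n) ≤ Real.exp (n * -c) := by
  obtain ⟨C₀, hC₀⟩ := hf.bounded
  obtain ⟨C, hC1, hC⟩ : ∃ C : ℝ, 0 < C ∧ ∀ p, |f p| ≤ C :=
    ⟨max C₀ 1, lt_max_of_lt_right one_pos, fun p => (hC₀ p).trans (le_max_left _ _)⟩
  obtain ⟨W, hW⟩ : ∃ W : ℕ, W = N + M + K + 1 := ⟨_, rfl⟩
  have hW0 : 0 < W := by omega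
  have hW1 : (0 : ℝ) < W := by exact_mod_cast hW0
  -- For `t = nε/2` and `m ≤ n` the Hoeffding exponent is at least `4cn`. Of this, `2cn` pays for
  -- the change of measure, `cn` for the prefactor `4W`, and `cn` is left.
  obtain ⟨c, hc⟩ : ∃ c : ℝ, 4 * c = ε ^ 2 / (8 * W ^ 2 * C ^ 2) :=
    ⟨ε ^ 2 / (8 * W ^ 2 * C ^ 2) / 4, by ring⟩
  have hcpos : 0 < c := by
    have : 0 < ε ^ 2 / (8 * W ^ 2 * C ^ 2) := by positivity
    linarith
  refine ⟨c, hcpos, fun δ hδ hδc => ?_⟩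
  have hlarge1 : ∀ᶠ n : ℕ in atTop, 8 * W * C ≤ n * ε :=
    (tendsto_natCast_atTop_atTop.atTop_mul_const hε).eventually_ge_atTop _
  have hlarge2 : ∀ᶠ n : ℕ in atTop, 4 * W ≤ Real.exp (n * c) :=
    (Real.tendsto_exp_atTop.comp
      (tendsto_natCast_atTop_atTop.atTop_mul_const hcpos)).eventually_ge_atTop _
  filter_upwards [eventually_cond_le ρ hθ hδ, hlarge1, hlarge2, eventually_ge_atTop (2 * W)]
    with n hcond h1 h2 h3
  obtain ⟨n, rfl⟩ := Nat.exists_eq_succ_of_ne_zero (by omega : n ≠ 0)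
  -- One full block is kept in reserve, so that every window starting before `m * W` fits into the
  -- horizon.
  obtain ⟨m, hm⟩ : ∃ m, (n + 1) / W = m + 1 :=
    Nat.exists_eq_succ_of_ne_zero (Nat.div_pos (by omega) hW0).ne'
  have hm1 : m * W + W ≤ n + 1 := by
    have := Nat.div_mul_le_self (n + 1) W
    rw [hm] at this
    linarith
  have hm2 : n + 1 ≤ m * W + 2 * W := by
    have := Nat.lt_div_mul_add (a := n + 1) hW0
    rw [hm] at this
    linarith
  have hm0 : 0 < m := by
    by_contra hcon
    have : (n + 1) / W ≥ 2 := (Nat.le_div_iff_mul_le hW0).2 h3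
    omega
  have hmn : (m : ℝ) ≤ (n + 1 : ℕ) := by
    have : m ≤ n + 1 := le_trans (Nat.le_mul_of_pos_right m hW0) (by omega)
    exact_mod_cast this
  have hm0' : (0 : ℝ) < m := by exact_mod_cast hm0
  have ht : (0 : ℝ) ≤ (n + 1 : ℕ) * ε / 2 := by positivity
  have hpi := pi_windowDeviationEvent_le ρ θ hf.measurable_windowFun
    (fun b => hC (unview N (periodize b))) (m := m) (n := n) (hW ▸ hm1) ht
  have hsub := hf.deviationEvent_subset hC ρ θ (hW ▸ hm1) (hW ▸ hm2) (hW ▸ h1)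
  refine (hcond _ _ (measurableSet_windowDeviationEvent hf.measurable_windowFun _ _ _ _)
    hsub).trans ?_
  have hexp : -((n + 1 : ℕ) * ε / 2 / W) ^ 2 / (2 * m * C ^ 2) ≤ -((n + 1 : ℕ) * (4 * c)) := by
    rw [hc, neg_div, neg_le_neg_iff, le_div_iff₀ (by positivity)]
    have h5 : ((n + 1 : ℕ) : ℝ) * (ε ^ 2 / (8 * W ^ 2 * C ^ 2)) * (2 * m * C ^ 2) =
        (n + 1 : ℕ) * m * (ε ^ 2 / (4 * W ^ 2)) := by
      field_simp
      ring
    have h6 : (((n + 1 : ℕ) : ℝ) * ε / 2 / W) ^ 2 =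
        (n + 1 : ℕ) * (n + 1 : ℕ) * (ε ^ 2 / (4 * W ^ 2)) := by
      field_simp
      ring
    rw [h5, h6]
    gcongr
  have hbound : 2 * ((N + M + K + 1 : ℕ) : ℝ) *
      Real.exp (-((n + 1 : ℕ) * ε / 2 / (N + M + K + 1 : ℕ)) ^ 2 / (2 * m * C ^ 2)) ≤
      2 * W * Real.exp (-((n + 1 : ℕ) * (4 * c))) := by
    rw [← hW]
    exact mul_le_mul_of_nonneg_left (Real.exp_le_exp.2 hexp) (by positivity)
  have hpi' := hpi.trans hbound
  calc _ ≤ 2 * Real.exp (2 * (n + 1 : ℕ) * (‖θ‖ * δ)) *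
        (2 * W * Real.exp (-((n + 1 : ℕ) * (4 * c)))) :=
        mul_le_mul_of_nonneg_left hpi' (by positivity)
    _ ≤ 2 * Real.exp (2 * (n + 1 : ℕ) * c) * (2 * W * Real.exp (-((n + 1 : ℕ) * (4 * c)))) := by
        gcongr
    _ = 4 * W * Real.exp ((n + 1 : ℕ) * (-2 * c)) := by
        have h7 : ((n + 1 : ℕ) : ℝ) * (-2 * c) =
            2 * (n + 1 : ℕ) * c + -((n + 1 : ℕ) * (4 * c)) := by ring
        rw [h7, Real.exp_add]
        ring
    _ ≤ Real.exp ((n + 1 : ℕ) * c) * Real.exp ((n + 1 : ℕ) * (-2 * c)) := by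
        gcongr
    _ = Real.exp ((n + 1 : ℕ) * -c) := by
        rw [← Real.exp_add]
        congr 1
        ring

/-- The rate `c` does not depend on `δ`, so the inner limit superior is at most `-c` as soon as
`‖θ‖δ ≤ c`. -/
theorem IsLocal.limsup_deviationEvent_neg {N M K : ℕ} {f : EnvSteps d → ℝ}
    (hf : IsLocal N M K f) (ρ : Measure (LocalEnv d)) [IsProbabilityMeasure ρ]
    {θ ξ : EuclideanSpace ℝ (Fin d)} (hθ : tiltedDrift ρ θ = ξ) {ε : ℝ} (hε : 0 < ε) :
    limsup (fun δ : ℝ => limsup (fun n : ℕ =>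
      ENNReal.log (ProbabilityTheory.cond (averagedMeasure ρ) (velocityEvent ξ δ n)
        (deviationEvent (tiltedMeasure ρ θ) f ε n)) / (n : EReal)) atTop) (𝓝[>] (0 : ℝ)) < 0 := by
  obtain ⟨c, hc, h⟩ := hf.eventually_cond_deviationEvent_le ρ hθ hε
  have hsmall : ∀ᶠ δ : ℝ in 𝓝[>] 0, ‖θ‖ * δ ≤ c := by
    have h1 : Tendsto (fun δ : ℝ => ‖θ‖ * δ) (𝓝[>] 0) (𝓝 0) := by
      have h2 : Continuous fun δ : ℝ => ‖θ‖ * δ := by fun_prop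
      have := h2.tendsto 0
      rw [mul_zero] at this
      exact this.mono_left nhdsWithin_le_nhds
    exact h1.eventually (ge_mem_nhds hc)
  have hle : ∀ᶠ δ : ℝ in 𝓝[>] 0, limsup (fun n : ℕ =>
      ENNReal.log (ProbabilityTheory.cond (averagedMeasure ρ) (velocityEvent ξ δ n)
        (deviationEvent (tiltedMeasure ρ θ) f ε n)) / (n : EReal)) atTop ≤ ((-c : ℝ) : EReal) := by
    filter_upwards [hsmall, self_mem_nhdsWithin] with δ hδ hδ0
    refine limsup_le_of_le (by isBoundedDefault) ?_
    filter_upwards [h δ hδ0 hδ, eventually_gt_atTop 0] with n hn hn0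
    exact log_div_le_of_real_le_exp (measure_ne_top _ _) hn0 hn
  refine (limsup_le_of_le (by isBoundedDefault) hle).trans_lt ?_
  exact_mod_cast neg_lt_zero.2 hc

end SpaceTimeRWRE

open SpaceTimeRWRE
theorem theorem1p18 {d : ℕ} (ρ : Measure (LocalEnv d)) [IsProbabilityMeasure ρ]
    (hell : ∃ c : ℝ, 0 < c ∧ ∀ z : Step d, ∀ᵐ s ∂ρ, c ≤ s.1 z)
    (ξ : EuclideanSpace ℝ (Fin d)) (hξ : ξ ∈ interior (velocitySet d)) :
    (∃! θ : EuclideanSpace ℝ (Fin d), HasGradientAt (logMGF ρ) ξ θ) ∧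
    ∃ μ : Measure (EnvSteps d),
      IsTiltedMeasure ρ ξ μ ∧
      (∀ μ' : Measure (EnvSteps d), IsTiltedMeasure ρ ξ μ' → μ' = μ) ∧
      (∀ δ : ℝ, 0 < δ → ∀ᶠ n : ℕ in atTop, averagedMeasure ρ (velocityEvent ξ δ n) ≠ 0) ∧
      ∀ (N M K : ℕ) (f : EnvSteps d → ℝ), IsLocal N M K f → ∀ ε : ℝ, 0 < ε →
        limsup (fun δ : ℝ => limsup (fun n : ℕ =>
            ENNReal.log (ProbabilityTheory.cond (averagedMeasure ρ) (velocityEvent ξ δ n)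
              (deviationEvent μ f ε n)) / (n : EReal)) atTop) (𝓝[>] (0 : ℝ)) < 0 := by
  obtain ⟨θ, hθ, huniq⟩ := existsUnique_hasGradientAt_logMGF ρ hell hξ
  have hdrift : tiltedDrift ρ θ = ξ := (hasGradientAt_logMGF_iff ρ θ ξ).1 hθ
  refine ⟨⟨θ, hθ, huniq⟩, tiltedMeasure ρ θ, isTiltedMeasure_tiltedMeasure ρ hθ, ?_, ?_, ?_⟩
  · rintro μ' ⟨hμ', θ', hθ', hint⟩
    -- The competitor comes with its own tilt, which uniqueness of the gradient equation identifies
    -- with `θ`.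
    obtain rfl := huniq θ' hθ'
    refine ext_of_integral_isLocal fun N M K f hf => ?_
    rw [hint N M K f hf, hf.integral_tiltedMeasure, hf.tiltedExpectation_eq]
  · intro δ hδ
    filter_upwards [eventually_averagedMeasure_velocityEvent_pos ρ hdrift hδ] with n hn h0
    simp [Measure.real, h0] at hn
  · exact fun N M K f hf ε hε => hf.limsup_deviationEvent_neg ρ hdrift hε
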